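/- Let $K$ be a field and let $\mathcal{G}=\mathrm{GA}_2(K)$ be the group, under composition, of polynomial automorphisms of the affine plane over $K$, i.e. of the (formal) polynomial maps $(x,y)\mapsto(P(x,y),Q(x,y))$ with $P,Q\in K[x,y]$ that have a polynomial inverse. The degree of such a map is the maximum of the total degrees of $P$ and $Q$. Let $\mathcal{A}$ be the set of affine maps $\mathbf{x}\mapsto M\mathbf{x}+\mathbf{a}$ with $M\in\mathrm{GL}(2,K)$, $\mathbf{a}\in K^2$; let $\mathcal{E}$ be the set of elementary maps $(x,y)\mapsto(\alpha x+P(y),\beta y+v)$ with $\alpha\beta\neq0$; and let $\mathcal{B}=\mathcal{A}\cap\mathcal{E}$. Let $$\mathcal{I}=\{(x,y)\mapsto(y,x+\beta y)\mid\beta\in K\},\qquad \mathcal{J}=\{(x,y)\mapsto(x+y^2P(y),y)\mid 0\neq P\in K[y]\}.$$ Every $g\in\mathcal{G}$ has a unique normal form $g=b\circ a_m\circ e_m\circ\dots\circ a_1\circ e_1$ with $m\geq1$, $b\in\mathcal{B}$, $a_i\in\mathcal{I}$, $e_i\in\mathcal{J}$, where $a_m$ and/or $e_1$ may be missing. It is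 called cyclically reduced if the word $b^{-1}g$ starts with a letter from $\mathcal{I}$ and ends with one from $\mathcal{J}$, or vice versa; then we say that $g$ has a cyclically reduced normal form (CRNF). The poly-degree of $g$ is $\mathrm{pd}(g)=(\deg e_m,\dots,\deg e_2,\deg e_1)$, where the last entry is dropped if $e_1$ is missing. An element of $\mathcal{G}$ is a CR element if it is conjugate in $\mathcal{G}$ to an element with a CRNF, and $g$ is reversible if $rgr^{-1}=g^{-1}$ for some $r\in\mathcal{G}$. 1. Let $g\in\mathcal{G}$ have a CRNF. Then $g^{-1}$ also has a CRNF, and $\mathrm{pd}(g^{-1})$ is the reversal of $\mathrm{pd}(g)$. If $g$ is reversible, then $\mathrm{pd}(g^{-1})$ is a cyclic permutation of $\mathrm{pd}(g)$. 2. Let $g'\in\mathcal{G}$ be a CR element, so that $g'$ is conjugate in $\mathcal{G}$ to some element $g$ with a CRNF. If $g'$ is reversible, then for every such $g$, $\mathrm{pd}(g^{-1})$ is a cyclic permutation of $\mathrm{pd}(g)$. Moreover, whether or not $g'$ is reversible, the validity of this condition does not depend on the choice of $g$: if $g_1,g_2$ have a CRNF and are both conjugate to $g'$, then $\mathrm{pd}(g_1^{-1})$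 is a cyclic permutation of $\mathrm{pd}(g_1)$ if and only if $\mathrm{pd}(g_2^{-1})$ is a cyclic permutation of $\mathrm{pd}(g_2)$. -/

import Mathlib

/-- The group `GA₂(K)`: polynomial maps `(x, y) ↦ (P(x, y), Q(x, y))` of the affine plane over `K`
together with a polynomial inverse.  The polynomials are formal, so that over a finite field maps
given by different polynomials are different. Coordinate `0` is `x`, coordinate `1` is `y`. -/
structure PolyAut (K : Type*) [Field K] where
  toPoly : Fin 2 → MvPolynomial (Fin 2) K
  invPoly : Fin 2 → MvPolynomial (Fin 2) K
  inv_comp : ∀ i, MvPolynomial.bind₁ toPoly (invPoly i) = MvPolynomial.X i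
  comp_inv : ∀ i, MvPolynomial.bind₁ invPoly (toPoly i) = MvPolynomial.X i

namespace PolyAut

open MvPolynomial

variable {K : Type*} [Field K]

/-- The inverse is determined by the map. -/
@[ext]
theorem ext {f g : PolyAut K} (h : ∀ i, f.toPoly i = g.toPoly i) : f = g := by
  have h1 : f.toPoly = g.toPoly := funext h
  have h2 : f.invPoly = g.invPoly := by
    funext i
    have e1 : bind₁ f.invPoly (bind₁ g.toPoly (g.invPoly i)) = f.invPoly i := by
      rw [g.inv_comp, bind₁_X_right]
    rw [← e1, ← h1, bind₁_bind₁]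
    simp only [f.comp_inv]
    simp
  cases f; cases g; simp_all

noncomputable instance : One (PolyAut K) where
  one := ⟨X, X, fun i => by simp, fun i => by simp⟩

/-- Composition: `f * g` is `f ∘ g`, that is, `g` is substituted into `f`. -/
noncomputable instance : Mul (PolyAut K) where
  mul f g :=
    { toPoly := fun i => bind₁ g.toPoly (f.toPoly i)
      invPoly := fun i => bind₁ f.invPoly (g.invPoly i)
      inv_comp := fun i => by
        rw [bind₁_bind₁]
        rw [show (fun j => bind₁ (fun k => bind₁ g.toPoly (f.toPoly k)) (f.invPoly j))
            = g.toPoly from funext fun j => by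
              rw [← bind₁_bind₁, f.inv_comp, bind₁_X_right]]
        exact g.inv_comp i
      comp_inv := fun i => by
        rw [bind₁_bind₁]
        rw [show (fun j => bind₁ (fun k => bind₁ f.invPoly (g.invPoly k)) (g.toPoly j))
            = f.invPoly from funext fun j => by
              rw [← bind₁_bind₁, g.comp_inv, bind₁_X_right]]
        exact f.comp_inv i }

instance : Inv (PolyAut K) where
  inv f := ⟨f.invPoly, f.toPoly, f.comp_inv, f.inv_comp⟩

theorem one_toPoly (i : Fin 2) : (1 : PolyAut K).toPoly i = X i := rfl

theorem mul_toPoly (f g : PolyAut K) (i : Fin 2) :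
    (f * g).toPoly i = bind₁ g.toPoly (f.toPoly i) := rfl

theorem inv_toPoly (f : PolyAut K) (i : Fin 2) : (f⁻¹).toPoly i = f.invPoly i := rfl

noncomputable instance : Group (PolyAut K) :=
  Group.ofLeftAxioms
    (fun f g h => ext fun i => by
      simp only [mul_toPoly, bind₁_bind₁]
      rfl)
    (fun f => ext fun i => by simp only [mul_toPoly, one_toPoly, bind₁_X_right])
    (fun f => ext fun i => by
      simp only [mul_toPoly, one_toPoly, inv_toPoly, f.inv_comp])

/-- The degree of a polynomial map: the larger one of the total degrees of its components. -/
noncomputable def degree (g : PolyAut K) : ℕ :=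
  max (g.toPoly 0).totalDegree (g.toPoly 1).totalDegree

/-- The affine transformations `𝐱 ↦ M 𝐱 + 𝐚` with `M` in `GL(2, K)`. -/
def affine (K : Type*) [Field K] : Set (PolyAut K) :=
  {g | ∃ (M : GL (Fin 2) K) (a : Fin 2 → K),
    ∀ i, g.toPoly i = C (M.1 i 0) * X 0 + C (M.1 i 1) * X 1 + C (a i)}

/-- The elementary transformations `(x, y) ↦ (α x + P(y), β y + v)` with `α β ≠ 0`. -/
def elementary (K : Type*) [Field K] : Set (PolyAut K) :=
  {g | ∃ (α β v : K) (P : Polynomial K), α * β ≠ 0 ∧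
    g.toPoly 0 = C α * X 0 + Polynomial.aeval (X 1) P ∧
    g.toPoly 1 = C β * X 1 + C v}

/-- The basic transformations, those which are both affine and elementary. -/
def basic (K : Type*) [Field K] : Set (PolyAut K) := affine K ∩ elementary K

/-- The coset representative `(x, y) ↦ (y, x + β y)`, the matrix with rows `0 1` and `1 β`. -/
noncomputable def affineRep (β : K) : PolyAut K where
  toPoly := ![X 1, X 0 + C β * X 1]
  invPoly := ![X 1 - C β * X 0, X 0]
  inv_comp i := by fin_cases i <;> simp
  comp_inv i := by fin_cases i <;> simp

/-- The coset representative `(x, y) ↦ (x + y² P(y), y)`. -/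
noncomputable def elementaryRep (P : Polynomial K) : PolyAut K where
  toPoly := ![X 0 + X 1 ^ 2 * Polynomial.aeval (X 1) P, X 1]
  invPoly := ![X 0 - X 1 ^ 2 * Polynomial.aeval (X 1) P, X 1]
  inv_comp i := by
    fin_cases i
    · simp [← Polynomial.aeval_algHom_apply]
    · simp
  comp_inv i := by
    fin_cases i
    · simp [← Polynomial.aeval_algHom_apply]
    · simp

/-- A letter of a normal form: a representative `(x, y) ↦ (y, x + β y)`, or a representative
`(x, y) ↦ (x + y² P(y), y)` with `P ≠ 0`. -/
inductive Letter (K : Type*) [Field K]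
  | aff (β : K) : Letter K
  | elem (P : Polynomial K) (hP : P ≠ 0) : Letter K

/-- Whether the letter is one of the affine representatives. -/
def Letter.isAff : Letter K → Bool
  | .aff _ => true
  | .elem _ _ => false

/-- The automorphism that a letter stands for. -/
noncomputable def Letter.toAut : Letter K → PolyAut K
  | .aff β => affineRep β
  | .elem P _ => elementaryRep P

/-- A normal form `b ∘ a_m ∘ e_m ∘ … ∘ a_1 ∘ e_1`, where `a_m` and/or `e_1` may be missing:
a basic transformation `b`, followed by a possibly empty alternating word in the representatives,
listed from left to right. -/
structure NormalForm (K : Type*) [Field K] where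
  b : PolyAut K
  b_mem : b ∈ basic K
  word : List (Letter K)
  alternating : word.IsChain (fun l l' => l.isAff ≠ l'.isAff)

namespace NormalForm

/-- The automorphism that a normal form represents. -/
noncomputable def toAut (w : NormalForm K) : PolyAut K :=
  w.b * (w.word.map Letter.toAut).prod

/-- The degrees of the elementary letters, from left to right:
`(deg e_m, …, deg e_2, deg e_1)`, where the last entry is dropped if `e_1` is missing. -/
noncomputable def degrees (w : NormalForm K) : List ℕ :=
  (w.word.filter fun l => !l.isAff).map fun l => l.toAut.degree

/-- The word (without `b`) starts with an affine letter and ends with an elementary one, or vice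
versa. -/
def IsCyclicallyReduced (w : NormalForm K) : Prop :=
  ∃ h : w.word ≠ [], (w.word.head h).isAff ≠ (w.word.getLast h).isAff

end NormalForm

/-- `g` has a cyclically reduced normal form. -/
def HasCRNF (g : PolyAut K) : Prop :=
  ∃ w : NormalForm K, w.toAut = g ∧ w.IsCyclicallyReduced

/-- `g` is a CR element: it is conjugate to an element with a cyclically reduced normal form. -/
def IsCR (g : PolyAut K) : Prop := ∃ g' : PolyAut K, IsConj g g' ∧ HasCRNF g'

open Classical in
/-- The poly-degree of `g`: the degrees of the elementary letters in its normal form. -/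
noncomputable def polyDegree (g : PolyAut K) : List ℕ :=
  if h : ∃ w : NormalForm K, w.toAut = g then h.choose.degrees else []

/-- `g` has a reversor within the group of polynomial automorphisms. -/
def IsReversible (g : PolyAut K) : Prop := ∃ r : PolyAut K, r * g * r⁻¹ = g⁻¹

/-- The condition on the poly-degree: `pd(g⁻¹)` is a cyclic permutation of `pd(g)`. -/
def PolyDegreeCondition (g : PolyAut K) : Prop := (polyDegree g⁻¹).IsRotated (polyDegree g)

end PolyAut

/-! ### Weighted degrees and leading forms of polynomials in two variables -/

namespace PolyAut

open MvPolynomial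

variable {K : Type*} [Field K]

/-! By the theorem of Jung and van der Kulk, the automorphism group is the amalgamated product of
the affine and the elementary group along their intersection, the basic group. In an amalgamated
product, conjugate cyclically reduced words agree up to a cyclic permutation and up to changing
letters by elements of the amalgamated subgroup. The degree of a non-affine elementary letter is
unaffected by basic factors on either side and by inversion. Hence the poly-degree, up to cyclic
permutation, is a conjugacy invariant of elements with a cyclically reduced normal form, and
inversion reverses it. A reversible element is conjugate to its inverse, and everything follows.

Generation (`mem_closure_affine_union_elementary`) is proved in every characteristic through
weighted leading forms. Let `f` be the first component of an automorphism and suppose that it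
involves both variables. The curve `f = 0` is a line parametrized by polynomials, so it has one
place at infinity: for suitable coprime weights the leading form of `f` divides a power of a
binomial `y ^ w₀ - c x ^ w₁` (`exists_leadForm_dvd`). Since `f` is part of a generating pair of
`K[x, y]`, one of the weights is `1` (`weight_eq_one_of_leadForm_dvd`). A shear then turns the
binomial into a multiple of a variable and lowers the degrees of `f` (`wdeg_bind₁_shear_lt`);
induction ends with `f` depending on one variable only.

Freeness (`isFree_factor`) follows from the growth of degrees along a reduced word (`wdeg_value`).
The conjugacy statement (`isRotated_profile`) holds in any group with such a pair of subgroups. -/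

/-- The substitution `xᵢ ↦ xᵢ T ^ wᵢ`, whose degree in `T` is the weighted degree. -/
noncomputable def weightHom (w : Fin 2 → ℕ) :
    MvPolynomial (Fin 2) K →ₐ[K] Polynomial (MvPolynomial (Fin 2) K) :=
  aeval fun i => Polynomial.C (X i) * Polynomial.X ^ w i

/-- The weighted degree of a polynomial (it is `0` for the zero polynomial). -/
noncomputable def wdeg (w : Fin 2 → ℕ) (h : MvPolynomial (Fin 2) K) : ℕ :=
  (weightHom w h).natDegree

/-- The leading form of a polynomial with respect to a weight. -/
noncomputable def leadForm (w : Fin 2 → ℕ) (h : MvPolynomial (Fin 2) K) :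
    MvPolynomial (Fin 2) K :=
  (weightHom w h).leadingCoeff

theorem weightHom_X (w : Fin 2 → ℕ) (i : Fin 2) :
    weightHom w (X i : MvPolynomial (Fin 2) K) = Polynomial.C (X i) * Polynomial.X ^ w i := by
  simp [weightHom]

theorem weightHom_C (w : Fin 2 → ℕ) (c : K) :
    weightHom w (C c) = Polynomial.C (C c) := by
  simp only [weightHom, aeval_C]
  rfl

theorem weightHom_monomial (w : Fin 2 → ℕ) (m : Fin 2 →₀ ℕ) (c : K) :
    weightHom w (monomial m c) =
      Polynomial.C (monomial m c) * Polynomial.X ^ (m 0 * w 0 + m 1 * w 1) := by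
  rw [weightHom, aeval_monomial, monomial_eq, Finsupp.prod_fintype _ _ (by simp),
    Finsupp.prod_fintype _ _ (by simp), Fin.prod_univ_two, Fin.prod_univ_two]
  rw [show algebraMap K (Polynomial (MvPolynomial (Fin 2) K)) c = Polynomial.C (C c) from rfl]
  simp only [map_mul, map_pow]
  ring

/-- Powers of `T` sort the monomials by weighted degree. Thus weighted degree and leading form are
`natDegree` and `leadingCoeff` of a polynomial over a domain, and inherit their rules. Weights may
vanish: `![1, 0]` and `![0, 1]` measure the degrees in `x` and in `y`. -/
theorem coeff_coeff_weightHom (w : Fin 2 → ℕ) (h : MvPolynomial (Fin 2) K) (d : ℕ)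
    (m : Fin 2 →₀ ℕ) :
    ((weightHom w h).coeff d).coeff m =
      if m 0 * w 0 + m 1 * w 1 = d then h.coeff m else 0 := by
  induction h using MvPolynomial.induction_on' with
  | monomial n c =>
    rw [weightHom_monomial, Polynomial.coeff_C_mul, Polynomial.coeff_X_pow]
    by_cases hnm : n = m
    · subst hnm
      simp only [eq_comm (a := d)]
      split_ifs <;> simp
    · split_ifs <;> simp [coeff_monomial, hnm]
  | add p q hp hq =>
    rw [map_add, Polynomial.coeff_add, coeff_add, hp, hq, coeff_add]
    split_ifs <;> simp

theorem weightHom_injective (w : Fin 2 → ℕ) :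
    Function.Injective (weightHom w : MvPolynomial (Fin 2) K →ₐ[K] _) := by
  refine (injective_iff_map_eq_zero _).2 fun h hh => ?_
  ext m
  have := coeff_coeff_weightHom w h (m 0 * w 0 + m 1 * w 1) m
  rw [if_pos rfl, hh] at this
  simpa using this.symm

theorem weightHom_eq_zero {w : Fin 2 → ℕ} {h : MvPolynomial (Fin 2) K} :
    weightHom w h = 0 ↔ h = 0 :=
  map_eq_zero_iff _ (weightHom_injective w)

theorem le_wdeg (w : Fin 2 → ℕ) {h : MvPolynomial (Fin 2) K} {m : Fin 2 →₀ ℕ}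
    (hm : h.coeff m ≠ 0) : m 0 * w 0 + m 1 * w 1 ≤ wdeg w h := by
  refine Polynomial.le_natDegree_of_ne_zero fun h0 => hm ?_
  have := coeff_coeff_weightHom w h (m 0 * w 0 + m 1 * w 1) m
  rw [if_pos rfl, h0] at this
  simpa using this.symm

theorem wdeg_le (w : Fin 2 → ℕ) {h : MvPolynomial (Fin 2) K} {N : ℕ}
    (hN : ∀ m, h.coeff m ≠ 0 → m 0 * w 0 + m 1 * w 1 ≤ N) : wdeg w h ≤ N := by
  refine Polynomial.natDegree_le_iff_coeff_eq_zero.2 fun d hd => ?_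
  ext m
  rw [coeff_coeff_weightHom, coeff_zero]
  split_ifs with h1
  · by_contra h2
    have := hN m h2
    omega
  · rfl

theorem coeff_leadForm (w : Fin 2 → ℕ) (h : MvPolynomial (Fin 2) K) (m : Fin 2 →₀ ℕ) :
    (leadForm w h).coeff m = if m 0 * w 0 + m 1 * w 1 = wdeg w h then h.coeff m else 0 :=
  coeff_coeff_weightHom w h _ m

theorem leadForm_eq_zero {w : Fin 2 → ℕ} {h : MvPolynomial (Fin 2) K} :
    leadForm w h = 0 ↔ h = 0 := by
  rw [leadForm, Polynomial.leadingCoeff_eq_zero, weightHom_eq_zero]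

theorem leadForm_mul (w : Fin 2 → ℕ) (p q : MvPolynomial (Fin 2) K) :
    leadForm w (p * q) = leadForm w p * leadForm w q := by
  rw [leadForm, map_mul, Polynomial.leadingCoeff_mul, leadForm, leadForm]

theorem leadForm_pow (w : Fin 2 → ℕ) (p : MvPolynomial (Fin 2) K) (n : ℕ) :
    leadForm w (p ^ n) = leadForm w p ^ n := by
  rw [leadForm, map_pow, Polynomial.leadingCoeff_pow, leadForm]

theorem wdeg_mul (w : Fin 2 → ℕ) {p q : MvPolynomial (Fin 2) K} (hp : p ≠ 0) (hq : q ≠ 0) :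
    wdeg w (p * q) = wdeg w p + wdeg w q := by
  rw [wdeg, map_mul, Polynomial.natDegree_mul (weightHom_eq_zero.not.2 hp)
    (weightHom_eq_zero.not.2 hq), wdeg, wdeg]

theorem wdeg_mul_le (w : Fin 2 → ℕ) (p q : MvPolynomial (Fin 2) K) :
    wdeg w (p * q) ≤ wdeg w p + wdeg w q := by
  rw [wdeg, map_mul]
  exact Polynomial.natDegree_mul_le

theorem wdeg_pow (w : Fin 2 → ℕ) (p : MvPolynomial (Fin 2) K) (n : ℕ) :
    wdeg w (p ^ n) = n * wdeg w p := by
  rw [wdeg, map_pow, Polynomial.natDegree_pow, wdeg]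

theorem wdeg_add_le (w : Fin 2 → ℕ) (p q : MvPolynomial (Fin 2) K) :
    wdeg w (p + q) ≤ max (wdeg w p) (wdeg w q) := by
  rw [wdeg, map_add]
  exact Polynomial.natDegree_add_le _ _

theorem wdeg_add_eq_left (w : Fin 2 → ℕ) {p q : MvPolynomial (Fin 2) K}
    (h : wdeg w q < wdeg w p) : wdeg w (p + q) = wdeg w p := by
  rw [wdeg, map_add]
  exact Polynomial.natDegree_add_eq_left_of_natDegree_lt h

theorem wdeg_add_eq_right (w : Fin 2 → ℕ) {p q : MvPolynomial (Fin 2) K}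
    (h : wdeg w p < wdeg w q) : wdeg w (p + q) = wdeg w q := by
  rw [add_comm, wdeg_add_eq_left w h]

theorem leadForm_add_eq_left (w : Fin 2 → ℕ) {p q : MvPolynomial (Fin 2) K}
    (h : wdeg w q < wdeg w p) : leadForm w (p + q) = leadForm w p := by
  rw [leadForm, map_add]
  exact Polynomial.leadingCoeff_add_of_degree_lt' (Polynomial.degree_lt_degree h)

/-- If the degree of the sum of two polynomials is smaller than the degree of a summand, then the
leading forms cancel. -/
theorem leadForm_eq_neg_of_wdeg_add_lt (w : Fin 2 → ℕ) {p q : MvPolynomial (Fin 2) K}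
    (h : wdeg w (p + q) < wdeg w q) : leadForm w q = -leadForm w p := by
  have h1 : wdeg w p = wdeg w q := by
    rcases lt_trichotomy (wdeg w p) (wdeg w q) with h2 | h2 | h2
    · rw [wdeg_add_eq_right w h2] at h; omega
    · exact h2
    · rw [wdeg_add_eq_left w h2] at h; omega
  have h2 : (weightHom w (p + q)).coeff (wdeg w q) = 0 :=
    Polynomial.coeff_eq_zero_of_natDegree_lt h
  rw [map_add, Polynomial.coeff_add] at h2
  have h3 : leadForm w p = (weightHom w p).coeff (wdeg w q) := by rw [← h1]; rfl
  rw [h3]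
  exact eq_neg_of_add_eq_zero_right h2

theorem wdeg_C (w : Fin 2 → ℕ) (c : K) : wdeg w (C c) = 0 := by
  rw [wdeg, weightHom_C, Polynomial.natDegree_C]

theorem wdeg_C_mul (w : Fin 2 → ℕ) {c : K} (hc : c ≠ 0) (p : MvPolynomial (Fin 2) K) :
    wdeg w (C c * p) = wdeg w p := by
  rcases eq_or_ne p 0 with rfl | hp
  · simp
  · rw [wdeg_mul w (C_ne_zero.2 hc) hp, wdeg_C, zero_add]

theorem wdeg_C_mul_le (w : Fin 2 → ℕ) (c : K) (p : MvPolynomial (Fin 2) K) :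
    wdeg w (C c * p) ≤ wdeg w p :=
  (wdeg_mul_le w _ _).trans (by rw [wdeg_C, zero_add])

theorem wdeg_X (w : Fin 2 → ℕ) (i : Fin 2) : wdeg w (X i : MvPolynomial (Fin 2) K) = w i := by
  rw [wdeg, weightHom_X, Polynomial.natDegree_C_mul_X_pow _ _ (X_ne_zero i)]

theorem leadForm_X (w : Fin 2 → ℕ) (i : Fin 2) :
    leadForm w (X i : MvPolynomial (Fin 2) K) = X i := by
  rw [leadForm, weightHom_X, Polynomial.leadingCoeff_C_mul_X_pow]

theorem weightHom_aeval (w : Fin 2 → ℕ) (P : Polynomial K) (f : MvPolynomial (Fin 2) K) :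
    weightHom w (Polynomial.aeval f P) = (P.map C).comp (weightHom w f) := by
  rw [← Polynomial.aeval_algHom_apply, Polynomial.comp, Polynomial.eval₂_map,
    Polynomial.aeval_def]
  rfl

theorem wdeg_aeval (w : Fin 2 → ℕ) (P : Polynomial K) (f : MvPolynomial (Fin 2) K) :
    wdeg w (Polynomial.aeval f P) = P.natDegree * wdeg w f := by
  rw [wdeg, weightHom_aeval, Polynomial.natDegree_comp,
    Polynomial.natDegree_map_eq_of_injective (C_injective _ _), wdeg]

theorem leadForm_aeval (w : Fin 2 → ℕ) (P : Polynomial K) {f : MvPolynomial (Fin 2) K}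
    (hf : 0 < wdeg w f) :
    leadForm w (Polynomial.aeval f P) = C P.leadingCoeff * leadForm w f ^ P.natDegree := by
  rw [leadForm, weightHom_aeval, Polynomial.leadingCoeff_comp hf.ne',
    Polynomial.natDegree_map_eq_of_injective (C_injective _ _),
    Polynomial.leadingCoeff_map_of_injective (C_injective _ _), leadForm]

/-- If a leading form does not vanish at a point with one coordinate `0`, then it contains a power
of the other coordinate. -/
theorem exists_coeff_of_eval_ne_zero {w : Fin 2 → ℕ} {h : MvPolynomial (Fin 2) K} {v : Fin 2 → K}
    {i : Fin 2} (hv : v i = 0) (he : eval v (leadForm w h) ≠ 0) :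
    ∃ m : Fin 2 →₀ ℕ, h.coeff m ≠ 0 ∧ m i = 0 ∧ m 0 * w 0 + m 1 * w 1 = wdeg w h := by
  rw [eval_eq'] at he
  obtain ⟨m, hm, hne⟩ := Finset.exists_ne_zero_of_sum_ne_zero he
  rw [mem_support_iff, coeff_leadForm] at hm
  rw [ne_eq, ite_eq_right_iff, Classical.not_imp] at hm
  refine ⟨m, hm.2, ?_, hm.1⟩
  by_contra h0
  exact hne (mul_eq_zero_of_right _ (Finset.prod_eq_zero (Finset.mem_univ i) (by simp [hv, h0])))

end PolyAut

/-! ### The leading form of a coordinate -/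

/-- Pseudo-division: over a domain the leading terms cancel after multiplication by the leading
coefficient of the divisor. It is needed over `K[f]`, which is not a field. -/
theorem Polynomial.exists_C_mul_eq_mul_add {A : Type*} [CommRing A] [IsDomain A]
    {φ : Polynomial A} (hφ : φ ≠ 0) (h : Polynomial A) :
    ∃ s : A, s ≠ 0 ∧ ∃ q r : Polynomial A,
      C s * h = q * φ + r ∧ (r = 0 ∨ r.natDegree < φ.natDegree) := by
  induction hn : h.natDegree using Nat.strong_induction_on generalizing h with
  | _ n ih =>
    rcases lt_or_ge h.natDegree φ.natDegree with hlt | hge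
    · exact ⟨1, one_ne_zero, 0, h, by simp, Or.inr hlt⟩
    rcases Nat.eq_zero_or_pos h.natDegree with h0 | h0
    -- Cancelling leading terms does not lower the degree of a constant, so a constant divisor is
    -- treated directly.
    · have hφ0 : φ.natDegree = 0 := by omega
      refine ⟨φ.coeff 0, ?_, h, 0, ?_, Or.inl rfl⟩
      · rw [← hφ0]; exact leadingCoeff_ne_zero.2 hφ
      · conv_rhs => rw [eq_C_of_natDegree_eq_zero hφ0]
        ring
    · obtain ⟨s, hs, q, r, he, hr⟩ := ih _
        (hn ▸ natDegree_cancelLeads_lt_of_natDegree_le_natDegree hge h0) (φ.cancelLeads h) rfl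
      refine ⟨s * φ.leadingCoeff, mul_ne_zero hs (leadingCoeff_ne_zero.2 hφ),
        q + C s * (C h.leadingCoeff * X ^ (h.natDegree - φ.natDegree)), r, ?_, hr⟩
      rw [cancelLeads, Nat.sub_eq_zero_of_le hge, pow_zero, mul_one] at he
      rw [C_mul]
      linear_combination he

namespace PolyAut

open MvPolynomial

variable {K : Type*} [Field K]

/-- Modulo `x`, every polynomial is congruent to its restriction to `x = 0`. So `(x)` is the kernel
of a map to the domain `K[T]`; this gives primality of `x` and, after an automorphism, describes the
multiples of any coordinate. -/
theorem X_zero_dvd_iff {p : MvPolynomial (Fin 2) K} :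
    X 0 ∣ p ↔ aeval ![0, (Polynomial.X : Polynomial K)] p = 0 := by
  constructor
  · rintro ⟨q, rfl⟩
    simp
  · intro h
    have key : ∀ q : MvPolynomial (Fin 2) K, X 0 ∣ q -
        Polynomial.aeval (X 1) (aeval ![0, (Polynomial.X : Polynomial K)] q) := by
      intro q
      induction q using MvPolynomial.induction_on with
      | C a =>
        rw [algHom_C, ← Polynomial.C_eq_algebraMap, Polynomial.aeval_C]
        simp [MvPolynomial.algebraMap_eq]
      | add p q hp hq => simpa [add_sub_add_comm] using dvd_add hp hq
      | mul_X p i hp =>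
        fin_cases i
        · simp
        · simpa [sub_mul] using hp.mul_right (X 1)
    simpa [h] using key p

theorem prime_X_zero : Prime (X 0 : MvPolynomial (Fin 2) K) := by
  refine ⟨X_ne_zero 0, fun h => ?_, fun p q h => ?_⟩
  · simpa using X_zero_dvd_iff.1 (h.dvd (a := (1 : MvPolynomial (Fin 2) K)))
  · simpa only [X_zero_dvd_iff, map_mul, mul_eq_zero] using h

theorem wdeg_neg (w : Fin 2 → ℕ) (p : MvPolynomial (Fin 2) K) : wdeg w (-p) = wdeg w p := by
  rw [wdeg, map_neg, Polynomial.natDegree_neg, wdeg]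

/-- A form that divides a power of `y ^ w₀ - c x ^ w₁`, with `c ≠ 0` and coprime weights `w₀`,
`w₁` of `x`, `y`, contains both a power of `x` and a power of `y`. -/
theorem exists_coeff_of_leadForm_dvd {w : Fin 2 → ℕ} (hw : ∀ i, 0 < w i) {c : K} (hc : c ≠ 0)
    {r : MvPolynomial (Fin 2) K} {M : ℕ}
    (hr : leadForm w r ∣ (X 1 ^ w 0 - C c * X 0 ^ w 1) ^ M) :
    (∃ m : Fin 2 →₀ ℕ, r.coeff m ≠ 0 ∧ m 0 = 0 ∧ m 1 * w 1 = wdeg w r) ∧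
    (∃ m : Fin 2 →₀ ℕ, r.coeff m ≠ 0 ∧ m 1 = 0 ∧ m 0 * w 0 = wdeg w r) := by
  -- The binomial takes the nonzero values `1` at `(0, 1)` and `-c` at `(1, 0)`, so its divisors do
  -- not vanish there either.
  have key : ∀ v : Fin 2 → K, eval v ((X 1 ^ w 0 - C c * X 0 ^ w 1) ^ M) ≠ 0 →
      eval v (leadForm w r) ≠ 0 := by
    intro v hv h0
    obtain ⟨β, hβ⟩ := hr
    rw [hβ, map_mul, h0, zero_mul] at hv
    exact hv rfl
  constructor
  · obtain ⟨m, h1, h2, h3⟩ := exists_coeff_of_eval_ne_zero (i := 0) (v := ![0, 1]) (by simp)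
      (key ![0, 1] (by simp [(hw 1).ne']))
    exact ⟨m, h1, h2, by rw [← h3, h2]; simp⟩
  · obtain ⟨m, h1, h2, h3⟩ := exists_coeff_of_eval_ne_zero (i := 1) (v := ![1, 0]) (by simp)
      (key ![1, 0] (by simp [(hw 0).ne', hc]))
    exact ⟨m, h1, h2, by rw [← h3, h2]; simp⟩

/-- A pure power of `x` and a pure power of `y` occur in this degree, so it is divisible by both
weights, which are coprime. -/
theorem mul_dvd_wdeg_of_leadForm_dvd {w : Fin 2 → ℕ} (hw : ∀ i, 0 < w i)
    (hcop : (w 0).Coprime (w 1)) {c : K} (hc : c ≠ 0) {r : MvPolynomial (Fin 2) K} {M : ℕ}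
    (hr : leadForm w r ∣ (X 1 ^ w 0 - C c * X 0 ^ w 1) ^ M) : w 0 * w 1 ∣ wdeg w r := by
  obtain ⟨⟨m, -, -, h1⟩, ⟨m', -, -, h2⟩⟩ := exists_coeff_of_leadForm_dvd hw hc hr
  exact hcop.mul_dvd_of_dvd_of_dvd (Dvd.intro_left _ h2) (Dvd.intro_left _ h1)

/-- If `f` and `g` generate `K[x, y]` and the leading form of `f` for coprime weights divides a
power of `y ^ w₀ - c x ^ w₁` with `c ≠ 0`, then one of the weights is `1`. -/
theorem weight_eq_one_of_leadForm_dvd {f g : MvPolynomial (Fin 2) K} {w : Fin 2 → ℕ}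
    (hw : ∀ i, 0 < w i) (hcop : (w 0).Coprime (w 1)) (hf : 0 < wdeg w f) {c : K} (hc : c ≠ 0)
    {M : ℕ} (hdvd : leadForm w f ∣ (X 1 ^ w 0 - C c * X 0 ^ w 1) ^ M)
    (hgen : ∀ i, ∃ H : Polynomial (Polynomial K),
      H.eval₂ (Polynomial.aeval f).toRingHom g = X i) :
    w 0 = 1 ∨ w 1 = 1 := by
  set ρ : Polynomial (Polynomial K) →+* MvPolynomial (Fin 2) K :=
    Polynomial.eval₂RingHom (Polynomial.aeval f).toRingHom g with hρ
  replace hgen : ∀ i, ∃ H, ρ H = X i := hgen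
  have hpow : ∀ {α : MvPolynomial (Fin 2) K} {N : ℕ}, α ∣ leadForm w f ^ N →
      α ∣ (X 1 ^ w 0 - C c * X 0 ^ w 1) ^ (M * N) := fun h =>
    h.trans (by rw [pow_mul]; exact pow_dvd_pow_of_dvd hdvd _)
  -- Expressions in `g` over `K[f]` whose leading form is not accounted for by that of `f`. One of
  -- minimal degree in `g` serves as divisor: every remainder is zero or has a leading form dividing
  -- a power of that of `f`.
  let S : Set (Polynomial (Polynomial K)) :=
    {H | ρ H ≠ 0 ∧ ¬ ∃ N, leadForm w (ρ H) ∣ leadForm w f ^ N}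
  have hS : S.Nonempty := by
    obtain ⟨H, hH⟩ := hgen 0
    refine ⟨H, by rw [hH]; exact X_ne_zero 0, ?_⟩
    rintro ⟨N, hN⟩
    rw [hH, leadForm_X] at hN
    obtain ⟨β, hβ⟩ := hpow hN
    have := congrArg (eval ![0, 1]) hβ
    simp [(hw 1).ne'] at this
  obtain ⟨φ, ⟨hφ0, hφ⟩, hmin⟩ :=
    (measure (fun H : Polynomial (Polynomial K) => H.natDegree)).wf.has_min S hS
  have key : ∀ i, w 0 * w 1 ∣ w i ∨ ∃ N, leadForm w (ρ φ) ∣ leadForm w f ^ N * X i := by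
    intro i
    obtain ⟨H, hH⟩ := hgen i
    obtain ⟨s, hs, q, r, he, hr⟩ :=
      Polynomial.exists_C_mul_eq_mul_add (φ := φ) (by rintro rfl; simp at hφ0) H
    have he' := congrArg ρ he
    rw [map_mul, map_add, map_mul, hH,
      show ρ (Polynomial.C s) = Polynomial.aeval f s from Polynomial.eval₂_C _ _] at he'
    set P := Polynomial.aeval f s * X i with hP
    have hlP : leadForm w P = C s.leadingCoeff * leadForm w f ^ s.natDegree * X i := by
      rw [hP, leadForm_mul, leadForm_X, leadForm_aeval w s hf]
    have hsf : Polynomial.aeval f s ≠ 0 := by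
      rw [ne_eq, ← leadForm_eq_zero (w := w), leadForm_aeval w s hf]
      refine mul_ne_zero (C_ne_zero.2 (Polynomial.leadingCoeff_ne_zero.2 hs))
        (pow_ne_zero _ (leadForm_eq_zero.not.2 ?_))
      rintro rfl
      simp [wdeg] at hf
    have hdP : wdeg w P = s.natDegree * wdeg w f + w i := by
      rw [hP, wdeg_mul w hsf (X_ne_zero i), wdeg_aeval, wdeg_X]
    have hfin : leadForm w (ρ q * ρ φ) = leadForm w P →
        ∃ N, leadForm w (ρ φ) ∣ leadForm w f ^ N * X i := by
      intro h
      refine ⟨s.natDegree, ?_⟩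
      have hu : IsUnit (C s.leadingCoeff : MvPolynomial (Fin 2) K) :=
        (isUnit_iff_ne_zero.2 (Polynomial.leadingCoeff_ne_zero.2 hs)).map C
      rw [leadForm_mul, hlP, mul_assoc] at h
      exact (hu.dvd_mul_left).1 (Dvd.intro_left _ h)
    by_cases hr0 : ρ r = 0
    · right
      rw [hr0, add_zero] at he'
      exact hfin (by rw [he'])
    have hrS : r ∉ S := fun h =>
      hmin r h (hr.resolve_left (by rintro rfl; simp at hr0))
    obtain ⟨N, hN⟩ : ∃ N, leadForm w (ρ r) ∣ leadForm w f ^ N := by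
      by_contra h
      exact hrS ⟨hr0, h⟩
    -- A small remainder leaves the leading form of `P` to the product `ρ q * ρ φ`. Equal degrees
    -- make `w₀ w₁` divide the degrees of both `P` and `f`, hence `wᵢ`. A large remainder cancels
    -- against the product, so the leading form of `ρ φ` would divide a power of that of `f`.
    rcases lt_trichotomy (wdeg w (ρ r)) (wdeg w P) with h | h | h
    · right
      refine hfin ?_
      rw [show ρ q * ρ φ = P + -ρ r by rw [he']; ring]
      exact leadForm_add_eq_left w (by rwa [wdeg_neg])
    · left
      have h1 := mul_dvd_wdeg_of_leadForm_dvd hw hcop hc (hpow hN)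
      have h2 := mul_dvd_wdeg_of_leadForm_dvd hw hcop hc hdvd
      rw [h, hdP] at h1
      exact (Nat.dvd_add_right (h2.mul_left _)).1 h1
    · exfalso
      rw [he'] at h
      have h1 := leadForm_eq_neg_of_wdeg_add_lt w h
      refine hφ ⟨N, dvd_trans ?_ hN⟩
      rw [h1, leadForm_mul, dvd_neg]
      exact dvd_mul_left _ _
  rcases key 0 with h0 | ⟨N, hN⟩
  · right
    exact Nat.dvd_one.1 (Nat.dvd_of_mul_dvd_mul_left (hw 0) (by simpa using h0))
  rcases key 1 with h1 | ⟨N', hN'⟩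
  · left
    exact Nat.dvd_one.1 (Nat.dvd_of_mul_dvd_mul_right (hw 1) (by simpa using h1))
  exfalso
  -- If the divisibility holds for both `x` and `y`, coprimality of the two variables removes them,
  -- which contradicts the choice of `φ`.
  obtain ⟨β, hβ⟩ : leadForm w (ρ φ) ∣ leadForm w f ^ (N + N') * X 0 :=
    hN.trans (mul_dvd_mul_right (pow_dvd_pow _ (Nat.le_add_right _ _)) _)
  obtain ⟨γ, hγ⟩ : leadForm w (ρ φ) ∣ leadForm w f ^ (N + N') * X 1 :=
    hN'.trans (mul_dvd_mul_right (pow_dvd_pow _ (Nat.le_add_left _ _)) _)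
  have hl : leadForm w (ρ φ) ≠ 0 := leadForm_eq_zero.not.2 hφ0
  have hx : β * X 1 = X 0 * γ := mul_left_cancel₀ hl (by linear_combination X 0 * hγ - X 1 * hβ)
  obtain ⟨β', rfl⟩ := ((prime_X_zero).dvd_or_dvd (Dvd.intro _ hx.symm)).resolve_right
    (by rw [X_dvd_X]; simp)
  exact hφ ⟨N + N', β', mul_right_cancel₀ (X_ne_zero 0) (hβ.trans (by ring))⟩

end PolyAut

/-! ### Embedded lines and their place at infinity -/

namespace PolyAut

open MvPolynomial

variable {K : Type*} [Field K]

theorem weightHom_binomial (w : Fin 2 → ℕ) (c : K) :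
    weightHom w (X 1 ^ w 0 - C c * X 0 ^ w 1) =
      Polynomial.C (X 1 ^ w 0 - C c * X 0 ^ w 1) * Polynomial.X ^ (w 0 * w 1) := by
  simp only [map_sub, map_mul, map_pow, weightHom_X, weightHom_C]
  ring

theorem leadForm_binomial (w : Fin 2 → ℕ) (c : K) :
    leadForm w (X 1 ^ w 0 - C c * X 0 ^ w 1) = X 1 ^ w 0 - C c * X 0 ^ w 1 := by
  rw [leadForm, weightHom_binomial, Polynomial.leadingCoeff_C_mul_X_pow]

theorem binomial_ne_zero {w : Fin 2 → ℕ} (hw : 0 < w 1) (c : K) :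
    (X 1 ^ w 0 - C c * X 0 ^ w 1 : MvPolynomial (Fin 2) K) ≠ 0 := by
  intro h
  have := congrArg (eval ![0, 1]) h
  simp [hw.ne'] at this

theorem wdeg_binomial {w : Fin 2 → ℕ} (hw : 0 < w 1) (c : K) :
    wdeg w (X 1 ^ w 0 - C c * X 0 ^ w 1) = w 0 * w 1 := by
  rw [wdeg, weightHom_binomial, Polynomial.natDegree_C_mul_X_pow _ _ (binomial_ne_zero hw c)]

theorem wdeg_le_of_dvd (w : Fin 2 → ℕ) {p q : MvPolynomial (Fin 2) K} (h : p ∣ q) (hq : q ≠ 0) :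
    wdeg w p ≤ wdeg w q := by
  obtain ⟨r, rfl⟩ := h
  rw [wdeg_mul w (left_ne_zero_of_mul hq) (right_ne_zero_of_mul hq)]
  exact Nat.le_add_right _ _

theorem bind₁_toPoly_bind₁_invPoly (g : PolyAut K) (p : MvPolynomial (Fin 2) K) :
    bind₁ g.toPoly (bind₁ g.invPoly p) = p := by
  rw [bind₁_bind₁, show (fun i => bind₁ g.toPoly (g.invPoly i)) = X from funext g.inv_comp,
    bind₁_X_left]
  rfl

/-- The restriction of polynomials to the curve `toPoly 0 = 0`, which the inverse parametrizes. -/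
noncomputable def restrict (g : PolyAut K) : MvPolynomial (Fin 2) K →ₐ[K] Polynomial K :=
  (aeval ![0, Polynomial.X]).comp (bind₁ g.invPoly)

theorem restrict_eq_zero_iff (g : PolyAut K) {p : MvPolynomial (Fin 2) K} :
    g.restrict p = 0 ↔ g.toPoly 0 ∣ p := by
  rw [restrict, AlgHom.comp_apply, ← X_zero_dvd_iff]
  constructor
  · intro h
    simpa [bind₁_toPoly_bind₁_invPoly] using map_dvd (bind₁ g.toPoly) h
  · intro h
    simpa [g.comp_inv] using map_dvd (bind₁ g.invPoly) h

theorem restrict_surjective (g : PolyAut K) : Function.Surjective g.restrict := by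
  intro q
  refine ⟨Polynomial.aeval (g.toPoly 1) q, ?_⟩
  rw [← Polynomial.aeval_algHom_apply, restrict, AlgHom.comp_apply, g.comp_inv]
  simp

/-- Polynomials on an embedded line lift to polynomials of essentially the same weighted degree. -/
theorem exists_lift_wdeg_le {π : MvPolynomial (Fin 2) K →ₐ[K] Polynomial K}
    (hπ : Function.Surjective π) {w : Fin 2 → ℕ} {e : ℕ} (hx : (π (X 0)).natDegree = e * w 0)
    (hpos : 0 < e * w 0) :
    ∃ B : ℕ, ∀ q, ∃ h, π h = q ∧ e * wdeg w h ≤ q.natDegree + B := by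
  choose h hh using fun i : ℕ => hπ (Polynomial.X ^ i)
  refine ⟨e * (Finset.range (e * w 0)).sup fun i => wdeg w (h i), fun q => ?_⟩
  set B := e * (Finset.range (e * w 0)).sup fun i => wdeg w (h i) with hB
  induction hd : q.degree using WellFoundedLT.induction generalizing q with
  | _ d ih =>
    rcases eq_or_ne q 0 with rfl | hq
    · exact ⟨0, map_zero _, by simp [wdeg]⟩
    -- Finitely many lifts suffice: the leading term of `q` is matched by `T ^ i` times a power of
    -- `π (X 0)`, with `i` below the degree of `π (X 0)`. Only the lift of `T ^ i` contributes to
    -- the error `B`.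
    set i := q.natDegree % (e * w 0) with hi
    set j := q.natDegree / (e * w 0) with hj
    have hij : e * w 0 * j + i = q.natDegree := Nat.div_add_mod _ _
    have hi_lt : i < e * w 0 := Nat.mod_lt _ hpos
    have hx0 : π (X 0) ≠ 0 := by
      intro h0
      rw [h0, Polynomial.natDegree_zero] at hx
      omega
    set p := π (h i * X 0 ^ j) with hp
    have hp' : p = Polynomial.X ^ i * π (X 0) ^ j := by rw [hp, map_mul, map_pow, hh]
    have hp0 : p ≠ 0 := by
      rw [hp']
      exact mul_ne_zero (pow_ne_zero _ Polynomial.X_ne_zero) (pow_ne_zero _ hx0)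
    have hpd : p.natDegree = q.natDegree := by
      rw [hp', Polynomial.natDegree_mul (pow_ne_zero _ Polynomial.X_ne_zero)
        (pow_ne_zero _ hx0), Polynomial.natDegree_pow, Polynomial.natDegree_pow, hx,
        Polynomial.natDegree_X, ← hij]
      ring
    set a := q.leadingCoeff / p.leadingCoeff with ha
    have hlp : p.leadingCoeff ≠ 0 := Polynomial.leadingCoeff_ne_zero.2 hp0
    have ha0 : a ≠ 0 := div_ne_zero (Polynomial.leadingCoeff_ne_zero.2 hq) hlp
    have hlt : (q - Polynomial.C a * p).degree < q.degree := by
      refine Polynomial.degree_sub_lt_left ?_ hq ?_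
      · rw [Polynomial.degree_C_mul ha0, Polynomial.degree_eq_natDegree hq,
          Polynomial.degree_eq_natDegree hp0, hpd]
      · rw [Polynomial.leadingCoeff_mul, Polynomial.leadingCoeff_C, ha, div_mul_cancel₀ _ hlp]
    obtain ⟨h', hh', hle⟩ := ih _ (hd ▸ hlt) _ rfl
    refine ⟨h' + C a * (h i * X 0 ^ j), ?_, ?_⟩
    · rw [map_add, hh', map_mul, ← hp, algHom_C]
      exact sub_add_cancel _ _
    · have h1 : e * wdeg w h' ≤ q.natDegree + B :=
        hle.trans (Nat.add_le_add_right (Polynomial.natDegree_le_natDegree hlt.le) _)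
      have h2 : wdeg w (C a * (h i * X 0 ^ j)) ≤ wdeg w (h i) + j * w 0 :=
        (wdeg_C_mul_le w _ _).trans ((wdeg_mul_le w _ _).trans (by rw [wdeg_pow, wdeg_X]))
      have h3 : e * wdeg w (h i) ≤ B :=
        Nat.mul_le_mul_left _ (Finset.le_sup (f := fun i => wdeg w (h i))
          (Finset.mem_range.2 hi_lt))
      have h4 : e * wdeg w (C a * (h i * X 0 ^ j)) ≤ q.natDegree + B := by
        calc _ ≤ e * (wdeg w (h i) + j * w 0) := Nat.mul_le_mul_left _ h2
          _ = e * wdeg w (h i) + e * w 0 * j := by ring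
          _ ≤ q.natDegree + B := by omega
      rcases le_max_iff.1 (wdeg_add_le w h' (C a * (h i * X 0 ^ j))) with h5 | h5
      · exact (Nat.mul_le_mul_left _ h5).trans h1
      · exact (Nat.mul_le_mul_left _ h5).trans h4

/-- If a coordinate function were constant on the curve, the equation of the curve would divide `xᵢ
- a` and could not involve the other variable. -/
theorem natDegree_restrict_pos (g : PolyAut K) (i : Fin 2) {w : Fin 2 → ℕ} (hw : w i = 0)
    (hg : 0 < wdeg w (g.toPoly 0)) : 0 < (g.restrict (X i)).natDegree := by
  by_contra h
  have h1 := Polynomial.eq_C_of_natDegree_eq_zero (Nat.eq_zero_of_not_pos h)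
  set a := (g.restrict (X i)).coeff 0
  have h2 : g.restrict (X i + C (-a)) = 0 := by
    rw [map_add, h1, algHom_C, ← Polynomial.C_eq_algebraMap, Polynomial.C_neg, add_neg_cancel]
  have h3 : (X i + C (-a) : MvPolynomial (Fin 2) K) ≠ 0 := by
    intro h0
    have := congrArg (fun p => eval (fun _ => a + 1) p) h0
    simp at this
  have h4 := wdeg_le_of_dvd w (g.restrict_eq_zero_iff.1 h2) h3
  have h5 := wdeg_add_le w (X i) (C (-a))
  rw [wdeg_X, wdeg_C, hw, max_self] at h5
  omega

/-- The leading form of a coordinate that involves both variables, for suitable weights, divides a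
power of a binomial: a coordinate has one place at infinity. -/
theorem exists_leadForm_dvd (g : PolyAut K) (hg0 : 0 < wdeg ![1, 0] (g.toPoly 0))
    (hg1 : 0 < wdeg ![0, 1] (g.toPoly 0)) :
    ∃ w : Fin 2 → ℕ, (∀ i, 0 < w i) ∧ (w 0).Coprime (w 1) ∧ ∃ c : K, c ≠ 0 ∧ ∃ M,
      leadForm w (g.toPoly 0) ∣ (X 1 ^ w 0 - C c * X 0 ^ w 1) ^ M := by
  have hx := g.natDegree_restrict_pos 0 (w := ![0, 1]) rfl hg1
  have hy := g.natDegree_restrict_pos 1 (w := ![1, 0]) rfl hg0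
  set x := g.restrict (X 0) with hxd
  set y := g.restrict (X 1) with hyd
  obtain ⟨e, n, a, he, hcop, hn, ha⟩ :=
    Nat.exists_coprime' (m := x.natDegree) (n := y.natDegree) (Nat.gcd_pos_of_pos_left _ hx)
  have hn0 : 0 < n := Nat.pos_of_mul_pos_right (hn ▸ hx)
  have ha0 : 0 < a := Nat.pos_of_mul_pos_right (ha ▸ hy)
  have hx0 : x ≠ 0 := by rintro h; simp [h] at hx
  have hy0 : y ≠ 0 := by rintro h; simp [h] at hy
  -- With this `c` the leading terms of `y ^ n` and `c x ^ a`, both of degree `e n a`, cancel on the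
  -- curve.
  set c := y.leadingCoeff ^ n / x.leadingCoeff ^ a with hc
  have hxl := pow_ne_zero a (Polynomial.leadingCoeff_ne_zero.2 hx0)
  have hyl := pow_ne_zero n (Polynomial.leadingCoeff_ne_zero.2 hy0)
  have hc0 : c ≠ 0 := div_ne_zero hyl hxl
  obtain ⟨B, hB⟩ := exists_lift_wdeg_le g.restrict_surjective (w := ![n, a]) (e := e)
    (by simpa [mul_comm] using hn) (by simpa using Nat.mul_pos he hn0)
  set w : Fin 2 → ℕ := ![n, a] with hw
  have hw1 : 0 < w 1 := ha0
  refine ⟨w, by rw [Fin.forall_fin_two]; exact ⟨hn0, ha0⟩, hcop, c, hc0, B + 1, ?_⟩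
  set Q : MvPolynomial (Fin 2) K := X 1 ^ w 0 - C c * X 0 ^ w 1 with hQ
  have hQr : g.restrict Q = y ^ n - Polynomial.C c * x ^ a := by
    rw [hQ, map_sub, map_mul, map_pow, map_pow, algHom_C]
    rfl
  have hdeg : (g.restrict Q).natDegree < e * (n * a) := by
    have hyn : (y ^ n).natDegree = e * (n * a) := by
      rw [Polynomial.natDegree_pow, ha]; ring
    have hxa : (x ^ a).natDegree = e * (n * a) := by
      rw [Polynomial.natDegree_pow, hn]; ring
    rcases eq_or_ne (g.restrict Q) 0 with h0 | h0
    · rw [h0, Polynomial.natDegree_zero]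
      positivity
    rw [← hyn]
    refine Polynomial.natDegree_lt_natDegree h0 ?_
    rw [hQr]
    refine Polynomial.degree_sub_lt_left ?_ (pow_ne_zero _ hy0) ?_
    · rw [Polynomial.degree_C_mul hc0, Polynomial.degree_eq_natDegree (pow_ne_zero _ hy0),
        Polynomial.degree_eq_natDegree (pow_ne_zero _ hx0), hyn, hxa]
    · rw [Polynomial.leadingCoeff_mul, Polynomial.leadingCoeff_C, Polynomial.leadingCoeff_pow,
        Polynomial.leadingCoeff_pow, hc, div_mul_cancel₀ _ hxl]
  -- Each factor `Q` loses at least one degree on the curve, so the power `B + 1` loses more than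
  -- the error `B` of lifting. The lift `h` then lies below `Q ^ (B + 1)`, and `f` divides a
  -- polynomial with leading form `Q ^ (B + 1)`.
  obtain ⟨h, hh, hle⟩ := hB (g.restrict (Q ^ (B + 1)))
  have hlt : wdeg w h < wdeg w (Q ^ (B + 1)) := by
    rw [wdeg_pow, wdeg_binomial hw1]
    rw [map_pow, Polynomial.natDegree_pow] at hle
    refine lt_of_mul_lt_mul_left (a := e) ?_ (Nat.zero_le _)
    calc e * wdeg w h ≤ (B + 1) * (g.restrict Q).natDegree + B := hle
      _ < (B + 1) * ((g.restrict Q).natDegree + 1) := by rw [mul_add]; omega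
      _ ≤ (B + 1) * (e * (n * a)) := Nat.mul_le_mul_left _ hdeg
      _ = e * ((B + 1) * (w 0 * w 1)) := mul_left_comm _ _ _
  have hdvd : g.toPoly 0 ∣ Q ^ (B + 1) + -h := by
    rw [← restrict_eq_zero_iff, map_add, map_neg, hh, add_neg_cancel]
  have hlead : leadForm w (Q ^ (B + 1) + -h) = Q ^ (B + 1) := by
    rw [leadForm_add_eq_left w (by rwa [wdeg_neg]), leadForm_pow, leadForm_binomial]
  obtain ⟨r, hr⟩ := hdvd
  rw [← hlead, hr, leadForm_mul]
  exact dvd_mul_right _ _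

end PolyAut

/-! ### The theorem of Jung and van der Kulk -/

namespace PolyAut

open MvPolynomial

variable {K : Type*} [Field K]

theorem bind₁_toPoly_injective (s : PolyAut K) : Function.Injective (bind₁ s.toPoly) :=
  Function.LeftInverse.injective (g := bind₁ s.invPoly) s⁻¹.bind₁_toPoly_bind₁_invPoly

/-- A substitution with weighted homogeneous components only changes the weights, and commutes with
taking leading forms. -/
theorem weightHom_bind₁ {w w' : Fin 2 → ℕ} {s : PolyAut K}
    (h : ∀ i, weightHom w (s.toPoly i) = Polynomial.C (s.toPoly i) * Polynomial.X ^ w' i)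
    (f : MvPolynomial (Fin 2) K) :
    weightHom w (bind₁ s.toPoly f) =
      (weightHom w' f).map (bind₁ s.toPoly : MvPolynomial (Fin 2) K →+* _) := by
  induction f using MvPolynomial.induction_on with
  | C a => simp
  | add p q hp hq => simp [hp, hq]
  | mul_X p i hp => simp [hp, h, weightHom_X]

theorem wdeg_bind₁ {w w' : Fin 2 → ℕ} {s : PolyAut K}
    (h : ∀ i, weightHom w (s.toPoly i) = Polynomial.C (s.toPoly i) * Polynomial.X ^ w' i)
    (f : MvPolynomial (Fin 2) K) : wdeg w (bind₁ s.toPoly f) = wdeg w' f := by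
  rw [wdeg, weightHom_bind₁ h]
  exact Polynomial.natDegree_map_eq_of_injective s.bind₁_toPoly_injective _

theorem leadForm_bind₁ {w w' : Fin 2 → ℕ} {s : PolyAut K}
    (h : ∀ i, weightHom w (s.toPoly i) = Polynomial.C (s.toPoly i) * Polynomial.X ^ w' i)
    (f : MvPolynomial (Fin 2) K) :
    leadForm w (bind₁ s.toPoly f) = bind₁ s.toPoly (leadForm w' f) := by
  rw [leadForm, weightHom_bind₁ h]
  exact Polynomial.leadingCoeff_map_of_injective s.bind₁_toPoly_injective _

/-! ### Reduction of degrees by shears and swaps -/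

/-- The transformation `(x, y) ↦ (x + P(y), y)`. -/
noncomputable def shear (P : Polynomial K) : PolyAut K where
  toPoly := ![X 0 + Polynomial.aeval (X 1) P, X 1]
  invPoly := ![X 0 - Polynomial.aeval (X 1) P, X 1]
  inv_comp i := by
    fin_cases i
    · simp [← Polynomial.aeval_algHom_apply]
    · simp
  comp_inv i := by
    fin_cases i
    · simp [← Polynomial.aeval_algHom_apply]
    · simp

/-- The transformation `(x, y) ↦ (y, x)`. -/
noncomputable def swap : PolyAut K where
  toPoly := ![X 1, X 0]
  invPoly := ![X 1, X 0]
  inv_comp i := by fin_cases i <;> simp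
  comp_inv i := by fin_cases i <;> simp

theorem shear_mem_elementary (P : Polynomial K) : shear P ∈ elementary K :=
  ⟨1, 1, 0, P, by simp, by simp [shear], by simp [shear]⟩

theorem swap_mem_affine : swap ∈ affine K :=
  ⟨Matrix.GeneralLinearGroup.mkOfDetNeZero !![0, 1; 1, 0] (by simp), 0, fun i => by
    fin_cases i <;> simp [swap, Matrix.GeneralLinearGroup.mkOfDetNeZero]⟩

theorem weightHom_swap (w : Fin 2 → ℕ) (i : Fin 2) :
    weightHom w ((swap : PolyAut K).toPoly i) =
      Polynomial.C (swap.toPoly i) * Polynomial.X ^ (![w 1, w 0] i) := by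
  fin_cases i <;> simp [swap, weightHom_X]

theorem weightHom_shear {w : Fin 2 → ℕ} (hw : w 1 = 1) (c : K) (i : Fin 2) :
    weightHom w ((shear (Polynomial.C c * Polynomial.X ^ w 0)).toPoly i) =
      Polynomial.C ((shear (Polynomial.C c * Polynomial.X ^ w 0)).toPoly i) *
        Polynomial.X ^ w i := by
  fin_cases i
  · simp [shear, weightHom_X, hw, MvPolynomial.algebraMap_eq]
    ring
  · simp [shear, weightHom_X]

/-- If the leading form of `f` divides a power of `y ^ n - c x` then the degrees of `f` drop under
a suitable elementary substitution. -/
theorem wdeg_bind₁_shear_lt {f : MvPolynomial (Fin 2) K} {w : Fin 2 → ℕ} (hw : 0 < w 0)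
    (hw1 : w 1 = 1) {c : K} (hc : c ≠ 0) {M : ℕ} (hf : 0 < wdeg w f)
    (hdvd : leadForm w f ∣ (X 1 ^ w 0 - C c * X 0 ^ w 1) ^ M) :
    wdeg ![1, 0] (bind₁ (shear (Polynomial.C c⁻¹ * Polynomial.X ^ w 0)).toPoly f) +
      wdeg ![0, 1] (bind₁ (shear (Polynomial.C c⁻¹ * Polynomial.X ^ w 0)).toPoly f) <
    wdeg ![1, 0] f + wdeg ![0, 1] f := by
  have hpos : ∀ i, 0 < w i := by rw [Fin.forall_fin_two, hw1]; exact ⟨hw, one_pos⟩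
  obtain ⟨⟨m, hm, hm0, hmd⟩, ⟨m', hm', hm0', hmd'⟩⟩ := exists_coeff_of_leadForm_dvd hpos hc hdvd
  set s := shear (Polynomial.C c⁻¹ * Polynomial.X ^ w 0) with hs
  have hd : wdeg w (bind₁ s.toPoly f) = wdeg w f := wdeg_bind₁ (weightHom_shear hw1 _) f
  -- The shear preserves the weighted degree and sends the binomial to `-c x`, so the new leading
  -- form divides a power of `x`.
  have hl : leadForm w (bind₁ s.toPoly f) ∣ X 0 ^ M := by
    have h1 := map_dvd (bind₁ s.toPoly) hdvd
    rw [← leadForm_bind₁ (weightHom_shear hw1 _)] at h1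
    have h2 : bind₁ s.toPoly (X 1 ^ w 0 - C c * X 0 ^ w 1) = C (-c) * X 0 := by
      have h3 : (C c * C c⁻¹ : MvPolynomial (Fin 2) K) = 1 := by
        rw [← C_mul, mul_inv_cancel₀ hc, C_1]
      simp only [hw1, pow_one, map_sub, map_pow, map_mul, bind₁_X_right, bind₁_C_right, hs, shear,
        Polynomial.aeval_C, Polynomial.aeval_X, MvPolynomial.algebraMap_eq, C_neg,
        Matrix.cons_val_zero, Matrix.cons_val_one]
      linear_combination (-X 1 ^ w 0) * h3
    rw [map_pow, h2, mul_pow] at h1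
    exact (((isUnit_iff_ne_zero.2 (neg_ne_zero.2 hc)).map C).pow M).dvd_mul_left.1 h1
  have h10 : wdeg ![1, 0] (bind₁ s.toPoly f) ≤ wdeg ![1, 0] f := by
    refine wdeg_le _ fun k hk => ?_
    have h1 := le_wdeg w hk
    have h2 := le_wdeg ![1, 0] hm'
    rw [hd, ← hmd'] at h1
    have h3 : k 0 ≤ m' 0 := le_of_mul_le_mul_right (by omega) hw
    simp only [Matrix.cons_val_zero, Matrix.cons_val_one] at h2 ⊢
    omega
  -- A monomial whose degree in `y` reached `wdeg w f` would be a pure power of `y` in the new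
  -- leading form, which is a constant multiple of a power of `x`. Since `f` itself contains that
  -- power of `y`, the degree in `y` drops strictly.
  have h01 : wdeg ![0, 1] (bind₁ s.toPoly f) ≤ wdeg w f - 1 := by
    refine wdeg_le _ fun k hk => ?_
    have h1 := le_wdeg w hk
    rw [hd, hw1] at h1
    simp only [Matrix.cons_val_zero, Matrix.cons_val_one]
    by_contra hlt
    have hk0 : k 0 * w 0 = 0 := by omega
    have hk0' : k 0 = 0 := (Nat.mul_eq_zero.1 hk0).resolve_right hw.ne'
    have hc : (leadForm w (bind₁ s.toPoly f)).coeff k ≠ 0 := by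
      rw [coeff_leadForm, if_pos (by rw [hd, hw1]; omega)]
      exact hk
    obtain ⟨j, -, hj⟩ := (dvd_prime_pow prime_X_zero M).1 hl
    obtain ⟨u, hu⟩ := hj.symm
    rw [← hu] at hc
    obtain ⟨a, -, ha⟩ := isUnit_iff_eq_C_of_isReduced.1 u.isUnit
    rcases j with _ | j
    · rw [pow_zero, one_mul, ha, coeff_C] at hc
      have : k = 0 := by
        by_contra h0
        exact hc (if_neg (Ne.symm h0))
      rw [this] at hlt
      simp at hlt
    · rw [pow_succ', mul_assoc, coeff_X_mul', if_neg (by simp [hk0'])] at hc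
      exact hc rfl
  have h4 := le_wdeg ![0, 1] hm
  simp only [Matrix.cons_val_zero, Matrix.cons_val_one] at h4
  rw [hw1] at hmd
  omega

theorem exists_eq_aeval_of_wdeg_eq_zero {f : MvPolynomial (Fin 2) K} (h : wdeg ![0, 1] f = 0) :
    ∃ P : Polynomial K, f = Polynomial.aeval (X 0) P := by
  refine ⟨∑ m ∈ f.support, Polynomial.C (f.coeff m) * Polynomial.X ^ m 0, ?_⟩
  conv_lhs => rw [f.as_sum]
  rw [map_sum]
  refine Finset.sum_congr rfl fun m hm => ?_
  have h1 := le_wdeg ![0, 1] (mem_support_iff.1 hm)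
  have h2 : m 1 = 0 := by
    simp only [Matrix.cons_val_zero, Matrix.cons_val_one] at h1
    omega
  rw [monomial_eq, Finsupp.prod_fintype _ _ (by simp), Fin.prod_univ_two, h2]
  simp [MvPolynomial.algebraMap_eq]

/-- Polynomials in `x` and `y` as polynomials in `y` with coefficients in `K[x]`. -/
noncomputable def toBivariate : MvPolynomial (Fin 2) K →ₐ[K] Polynomial (Polynomial K) :=
  aeval ![Polynomial.C Polynomial.X, Polynomial.X]

theorem eval₂_toBivariate (f : Fin 2 → MvPolynomial (Fin 2) K) (p : MvPolynomial (Fin 2) K) :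
    (toBivariate p).eval₂ (Polynomial.aeval (f 0)).toRingHom (f 1) = bind₁ f p := by
  induction p using MvPolynomial.induction_on with
  | C c =>
    rw [algHom_C, bind₁_C_right]
    simp [Polynomial.algebraMap_apply, MvPolynomial.algebraMap_eq]
  | add p q hp hq => rw [map_add, Polynomial.eval₂_add, hp, hq, map_add]
  | mul_X p i hp =>
    rw [map_mul, Polynomial.eval₂_mul, hp, map_mul]
    congr 1
    fin_cases i <;> simp [toBivariate]

/-- An automorphism whose first component depends on `x` only is conjugate by the swap to an
elementary one. -/
theorem swap_mul_mul_swap_mem_elementary {g : PolyAut K} (hg : wdeg ![0, 1] (g.toPoly 0) = 0) :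
    swap * g * swap ∈ elementary K := by
  obtain ⟨P, hP⟩ := exists_eq_aeval_of_wdeg_eq_zero hg
  -- Substituting the inverse turns `P` of a polynomial into `x`, so the degrees multiply to `1`.
  have hP1 : P.natDegree = 1 := by
    have h1 := congrArg (wdeg ![1, 1]) (g.comp_inv 0)
    rw [hP, ← Polynomial.aeval_algHom_apply, wdeg_aeval, wdeg_X] at h1
    exact Nat.eq_one_of_mul_eq_one_right h1
  obtain ⟨a, ha, b, rfl⟩ := Polynomial.natDegree_eq_one.1 hP1
  have hg0 : toBivariate (g.toPoly 0) =
      Polynomial.C (Polynomial.C a * Polynomial.X + Polynomial.C b) := by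
    rw [hP]
    simp [toBivariate, Polynomial.algebraMap_apply, MvPolynomial.algebraMap_eq]
  set G := toBivariate (g.toPoly 1) with hG
  have hcomp : ∀ p : MvPolynomial (Fin 2) K,
      (aeval ![toBivariate (g.toPoly 0), Polynomial.X] p : Polynomial (Polynomial K)).comp G =
        toBivariate (bind₁ g.toPoly p) := by
    intro p
    induction p using MvPolynomial.induction_on with
    | C c => simp [Polynomial.algebraMap_apply]
    | add p q hp hq => rw [map_add, Polynomial.add_comp, hp, hq, map_add, map_add]
    | mul_X p i hp =>
      rw [map_mul, Polynomial.mul_comp, hp, map_mul, map_mul]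
      congr 1
      fin_cases i
      · simp [hg0]
      · simp [hG]
  -- Over `K[x]`, the second component has a left inverse under composition in `y`. So it is linear
  -- in `y`, with a unit of `K[x]`, that is a nonzero constant, as leading coefficient.
  have hVG := hcomp (g.invPoly 1)
  set V : Polynomial (Polynomial K) :=
    aeval ![toBivariate (g.toPoly 0), Polynomial.X] (g.invPoly 1)
  rw [g.inv_comp, show toBivariate (X 1 : MvPolynomial (Fin 2) K) = Polynomial.X by
    simp [toBivariate]] at hVG
  have hdeg := congrArg Polynomial.natDegree hVG
  rw [Polynomial.natDegree_comp, Polynomial.natDegree_X] at hdeg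
  obtain ⟨v₁, -, v₀, hV⟩ := Polynomial.natDegree_eq_one.1 (Nat.eq_one_of_mul_eq_one_right hdeg)
  obtain ⟨g₁, -, g₀, hGe⟩ := Polynomial.natDegree_eq_one.1 (Nat.eq_one_of_mul_eq_one_left hdeg)
  have hunit : v₁ * g₁ = 1 := by
    have := congrArg (fun p => Polynomial.coeff p 1) hVG
    simpa [← hV, ← hGe, Polynomial.coeff_C] using this
  obtain ⟨γ, hγ, rfl⟩ := Polynomial.isUnit_iff.1 (IsUnit.of_mul_eq_one_right _ hunit)
  have hg1 : g.toPoly 1 = C γ * X 1 + Polynomial.aeval (X 0) g₀ := by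
    have h1 := eval₂_toBivariate X (g.toPoly 1)
    rw [bind₁_X_left, ← hG, ← hGe] at h1
    rw [show g.toPoly 1 = AlgHom.id K _ (g.toPoly 1) from rfl, ← h1]
    simp [MvPolynomial.algebraMap_eq]
  refine ⟨γ, a, b, g₀, mul_ne_zero hγ.ne_zero ha, ?_, ?_⟩
  · simp [mul_toPoly, swap, hg1, ← Polynomial.aeval_algHom_apply]
  · simp [mul_toPoly, swap, hP, MvPolynomial.algebraMap_eq]

/-- Induction on the sum of the degrees in `x` and in `y` of the first component alone; the second
one matters only as its partner in generating `K[x, y]`. -/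
theorem mem_closure_affine_union_elementary (g : PolyAut K) :
    g ∈ Subgroup.closure (affine K ∪ elementary K) := by
  have hS : ∀ s ∈ affine K ∪ elementary K, s ∈ Subgroup.closure (affine K ∪ elementary K) :=
    fun s hs => Subgroup.subset_closure hs
  have hswap : swap ∈ Subgroup.closure (affine K ∪ elementary K) := hS _ (Or.inl swap_mem_affine)
  induction hN : wdeg ![1, 0] (g.toPoly 0) + wdeg ![0, 1] (g.toPoly 0)
    using Nat.strong_induction_on generalizing g with
  | _ N ih =>
    have base : ∀ g : PolyAut K, wdeg ![0, 1] (g.toPoly 0) = 0 →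
        g ∈ Subgroup.closure (affine K ∪ elementary K) := by
      intro g h
      have h1 := hS _ (Or.inr (swap_mul_mul_swap_mem_elementary h))
      rwa [Subgroup.mul_mem_cancel_right _ hswap, Subgroup.mul_mem_cancel_left _ hswap] at h1
    have hsw : ∀ w, wdeg w ((g * swap).toPoly 0) = wdeg ![w 1, w 0] (g.toPoly 0) := fun w =>
      wdeg_bind₁ (weightHom_swap w) _
    rcases Nat.eq_zero_or_pos (wdeg ![0, 1] (g.toPoly 0)) with h1 | h1
    · exact base g h1
    rcases Nat.eq_zero_or_pos (wdeg ![1, 0] (g.toPoly 0)) with h0 | h0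
    · exact (Subgroup.mul_mem_cancel_right _ hswap).1 (base (g * swap) (by rw [hsw]; exact h0))
    have reduce : ∀ (g : PolyAut K) (w : Fin 2 → ℕ) (c : K) (M : ℕ), 0 < w 0 → w 1 = 1 → c ≠ 0 →
        0 < wdeg w (g.toPoly 0) →
        leadForm w (g.toPoly 0) ∣ (X 1 ^ w 0 - C c * X 0 ^ w 1) ^ M →
        wdeg ![1, 0] (g.toPoly 0) + wdeg ![0, 1] (g.toPoly 0) = N →
        g ∈ Subgroup.closure (affine K ∪ elementary K) := by
      intro g w c M hw0 hw1 hc hd hdvd hgN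
      have h2 := wdeg_bind₁_shear_lt hw0 hw1 hc hd hdvd
      rw [hgN] at h2
      exact (Subgroup.mul_mem_cancel_right _ (hS _ (Or.inr (shear_mem_elementary _)))).1
        (ih _ h2 (g * shear (Polynomial.C c⁻¹ * Polynomial.X ^ w 0)) rfl)
    obtain ⟨w, hw, hcop, c, hc, M, hdvd⟩ := g.exists_leadForm_dvd h0 h1
    have hd : 0 < wdeg w (g.toPoly 0) := by
      by_contra hd
      refine h0.not_ge (wdeg_le _ fun m hm => ?_)
      have h2 := le_wdeg w hm
      have h3 : m 0 * w 0 = 0 := by omega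
      simp [(Nat.mul_eq_zero.1 h3).resolve_right (hw 0).ne']
    have hgen : ∀ i, ∃ H : Polynomial (Polynomial K),
        H.eval₂ (Polynomial.aeval (g.toPoly 0)).toRingHom (g.toPoly 1) = X i := fun i =>
      ⟨toBivariate (g.invPoly i), by rw [eval₂_toBivariate, g.inv_comp]⟩
    rcases weight_eq_one_of_leadForm_dvd hw hcop hd hc hdvd hgen with h | h
    -- If the weight of `x` is `1`, the swap exchanges the roles of the variables; it turns the
    -- binomial into `-c` times the one with constant `c⁻¹`.
    · have hww : ![(![w 1, 1] : Fin 2 → ℕ) 1, (![w 1, 1] : Fin 2 → ℕ) 0] = w := by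
        ext i
        fin_cases i <;> simp [h]
      have hl : leadForm ![w 1, 1] ((g * swap).toPoly 0) =
          bind₁ swap.toPoly (leadForm w (g.toPoly 0)) := by
        rw [mul_toPoly, leadForm_bind₁ (weightHom_swap _), hww]
      refine (Subgroup.mul_mem_cancel_right _ hswap).1
        (reduce (g * swap) ![w 1, 1] c⁻¹ M (hw 1) rfl (inv_ne_zero hc) ?_ ?_ ?_)
      · rwa [hsw, hww]
      · rw [hl]
        refine (map_dvd (bind₁ swap.toPoly) hdvd).trans ?_
        have h2 : bind₁ swap.toPoly (X 1 ^ w 0 - C c * X 0 ^ w 1) =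
            C (-c) * (X 1 ^ w 1 - C c⁻¹ * X 0 ^ 1) := by
          have h3 : (C c * C c⁻¹ : MvPolynomial (Fin 2) K) = 1 := by
            rw [← C_mul, mul_inv_cancel₀ hc, C_1]
          simp only [map_sub, map_pow, map_mul, bind₁_X_right, bind₁_C_right, swap,
            C_neg, Matrix.cons_val_zero, Matrix.cons_val_one, h]
          linear_combination (-X 0) * h3
        rw [map_pow, h2, mul_pow]
        exact (((isUnit_iff_ne_zero.2 (neg_ne_zero.2 hc)).map C).pow M).mul_left_dvd.2 dvd_rfl
      · rw [hsw, hsw, ← hN, add_comm]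
        rfl
    · exact reduce g w c M (hw 0) h hc hd hdvd hN

end PolyAut

/-! ### Words in two subgroups amalgamated along their intersection -/

namespace AmalgamWord

variable {G : Type*}

/-- The types of the letters together with their weights. -/
def profile (D : Bool → G → ℕ) (l : List (Bool × G)) : List (Bool × ℕ) :=
  l.map fun p => (p.1, D p.1 p.2)

@[simp] theorem length_profile (D : Bool → G → ℕ) (l : List (Bool × G)) :
    (profile D l).length = l.length := by simp [profile]

@[simp] theorem profile_cons (D : Bool → G → ℕ) (p : Bool × G) (l : List (Bool × G)) :
    profile D (p :: l) = (p.1, D p.1 p.2) :: profile D l := rfl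

@[simp] theorem profile_append (D : Bool → G → ℕ) (l l' : List (Bool × G)) :
    profile D (l ++ l') = profile D l ++ profile D l' := by simp [profile]

variable [Group G]

/-- The intersection of the two subgroups. -/
def core (H : Bool → Subgroup G) : Subgroup G := H true ⊓ H false

theorem core_le (H : Bool → Subgroup G) (i : Bool) : core H ≤ H i := by
  cases i
  · exact inf_le_right
  · exact inf_le_left

/-- Words with letters alternately in the two subgroups, none of them in the intersection. -/
structure IsReduced (H : Bool → Subgroup G) (l : List (Bool × G)) : Prop where
  mem : ∀ p ∈ l, p.2 ∈ H p.1 ∧ p.2 ∉ core H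
  chain : l.IsChain fun p q => p.1 ≠ q.1

/-- The element that a word represents. -/
def value (l : List (Bool × G)) : G := (l.map Prod.snd).prod

/-- The inverse word. -/
def invWord (l : List (Bool × G)) : List (Bool × G) :=
  (l.map fun p => (p.1, p.2⁻¹)).reverse

/-- No nonempty reduced word represents an element of the intersection: the subgroup generated by
the two subgroups is their amalgamated product. -/
def IsFree (H : Bool → Subgroup G) : Prop :=
  ∀ l, IsReduced H l → l ≠ [] → value l ∉ core H

/-- Weights of letters that are invariant under the intersection and under inversion. -/
structure IsWeight (H : Bool → Subgroup G) (D : Bool → G → ℕ) : Prop where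
  mul_left : ∀ i x c, x ∈ H i → x ∉ core H → c ∈ core H → D i (c * x) = D i x
  mul_right : ∀ i x c, x ∈ H i → x ∉ core H → c ∈ core H → D i (x * c) = D i x
  inv : ∀ i x, x ∈ H i → x ∉ core H → D i x⁻¹ = D i x

@[simp] theorem value_nil : value ([] : List (Bool × G)) = 1 := rfl

@[simp] theorem value_cons (p : Bool × G) (l : List (Bool × G)) :
    value (p :: l) = p.2 * value l := by simp [value]

@[simp] theorem value_append (l l' : List (Bool × G)) :
    value (l ++ l') = value l * value l' := by simp [value]

@[simp] theorem invWord_nil : invWord ([] : List (Bool × G)) = [] := rfl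

@[simp] theorem invWord_cons (p : Bool × G) (l : List (Bool × G)) :
    invWord (p :: l) = invWord l ++ [(p.1, p.2⁻¹)] := by simp [invWord]

@[simp] theorem length_invWord (l : List (Bool × G)) : (invWord l).length = l.length := by
  simp [invWord]

@[simp] theorem value_invWord (l : List (Bool × G)) : value (invWord l) = (value l)⁻¹ := by
  induction l with
  | nil => simp
  | cons p l ih => simp [ih]

theorem getLast?_invWord (l : List (Bool × G)) :
    (invWord l).getLast? = l.head?.map fun p => (p.1, p.2⁻¹) := by
  simp [invWord]

theorem head?_invWord (l : List (Bool × G)) :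
    (invWord l).head? = l.getLast?.map fun p => (p.1, p.2⁻¹) := by
  simp [invWord]

variable {H : Bool → Subgroup G}

theorem isReduced_nil : IsReduced H [] := ⟨by simp, .nil⟩

theorem isReduced_append {l l' : List (Bool × G)} :
    IsReduced H (l ++ l') ↔ IsReduced H l ∧ IsReduced H l' ∧
      ∀ p ∈ l.getLast?, ∀ q ∈ l'.head?, p.1 ≠ q.1 := by
  constructor
  · rintro ⟨h1, h2⟩
    rw [List.isChain_append] at h2
    exact ⟨⟨fun p hp => h1 p (by simp [hp]), h2.1⟩,
      ⟨fun p hp => h1 p (by simp [hp]), h2.2.1⟩, h2.2.2⟩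
  · rintro ⟨⟨h1, h2⟩, ⟨h3, h4⟩, h5⟩
    exact ⟨fun p hp => (List.mem_append.1 hp).elim (h1 p) (h3 p),
      List.isChain_append.2 ⟨h2, h4, h5⟩⟩

theorem isReduced_cons {p : Bool × G} {l : List (Bool × G)} :
    IsReduced H (p :: l) ↔ (p.2 ∈ H p.1 ∧ p.2 ∉ core H) ∧ (∀ q ∈ l.head?, p.1 ≠ q.1) ∧
      IsReduced H l := by
  constructor
  · rintro ⟨h1, h2⟩
    rw [List.isChain_cons] at h2
    exact ⟨h1 p (by simp), h2.1, fun q hq => h1 q (by simp [hq]), h2.2⟩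
  · rintro ⟨h1, h2, h3, h4⟩
    refine ⟨fun q hq => ?_, List.isChain_cons.2 ⟨h2, h4⟩⟩
    rcases List.mem_cons.1 hq with rfl | hq
    · exact h1
    · exact h3 q hq

theorem IsReduced.invWord {l : List (Bool × G)} (hl : IsReduced H l) :
    IsReduced H (invWord l) := by
  constructor
  · intro p hp
    simp only [AmalgamWord.invWord, List.mem_reverse, List.mem_map] at hp
    obtain ⟨q, hq, rfl⟩ := hp
    simpa using hl.mem q hq
  · rw [AmalgamWord.invWord, List.isChain_reverse, List.isChain_map]
    exact hl.chain.imp fun _ _ h => h.symm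

theorem profile_invWord {D : Bool → G → ℕ} (hD : IsWeight H D) {l : List (Bool × G)}
    (hl : IsReduced H l) : profile D (invWord l) = (profile D l).reverse := by
  rw [profile, invWord, List.map_reverse, List.map_map, profile]
  congr 1
  refine List.map_congr_left fun p hp => ?_
  simp [hD.inv p.1 p.2 (hl.mem p hp).1 (hl.mem p hp).2]

/-- An alternating list of truth values has even length if and only if its ends differ. -/
theorem even_length_iff {α : Type*} (t : α → Bool) :
    ∀ {l : List α}, l.IsChain (fun p q => t p ≠ t q) → ∀ p ∈ l.head?, ∀ q ∈ l.getLast?,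
      (Even l.length ↔ t p ≠ t q)
  | [], _, p, hp, _, _ => by simp at hp
  | [a], _, p, hp, q, hq => by simp_all
  | a :: b :: l, h, p, hp, q, hq => by
    rw [List.isChain_cons_cons] at h
    have ih := even_length_iff t h.2 b (by simp) q (by simpa using hq)
    simp only [List.head?_cons, Option.mem_def, Option.some.injEq] at hp
    subst hp
    rw [List.length_cons, Nat.even_add_one, ih]
    have := h.1
    revert this
    cases t a <;> cases t b <;> cases t q <;> simp

theorem mul_mem_core_iff_left {c x : G} (hc : c ∈ core H) : c * x ∈ core H ↔ x ∈ core H :=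
  Subgroup.mul_mem_cancel_left _ hc

/-! ### Uniqueness of reduced words and conjugacy -/

/-- The types and weights of the letters of a reduced word are determined by the double coset of
the element that it represents. -/
theorem profile_eq_of_mul_value_eq (hH : IsFree H) {D : Bool → G → ℕ} (hD : IsWeight H D)
    {xs ys : List (Bool × G)} (hx : IsReduced H xs) (hy : IsReduced H ys) {c c' : G}
    (hc : c ∈ core H) (hc' : c' ∈ core H) (h : c * value xs = value ys * c') :
    profile D xs = profile D ys := by
  induction xs generalizing c ys with
  | nil =>
    rcases ys with _ | ⟨q, ys⟩
    · rfl
    · refine absurd ?_ (hH _ hy (by simp))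
      rw [← eq_mul_inv_iff_mul_eq] at h
      rw [← Subgroup.mul_mem_cancel_right _ hc', ← eq_mul_inv_iff_mul_eq.1 h]
      simpa using hc
  | cons p xs ih =>
    obtain ⟨i, x⟩ := p
    rcases ys with _ | ⟨⟨j, y⟩, ys⟩
    · refine absurd ?_ (hH _ hx (by simp))
      rw [← mul_mem_core_iff_left hc, h]
      simpa using hc'
    obtain ⟨hx1, hx2, hx3⟩ := isReduced_cons.1 hx
    obtain ⟨hy1, hy2, hy3⟩ := isReduced_cons.1 hy
    simp only [value_cons] at h hx1 hy1 hx2 hy2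
    by_cases hij : i = j
    · subst hij
      have hz : y⁻¹ * (c * x) * value xs = value ys * c' := by
        rw [mul_assoc, mul_assoc, h]; group
      -- An intermediate factor in the core is passed on to the tails. Otherwise it joins the
      -- inverse of one tail and the other tail to a reduced word with value in the core, contrary
      -- to freeness.
      by_cases hzc : y⁻¹ * (c * x) ∈ core H
      · rw [profile_cons, profile_cons, ih hx3 hy3 hzc hz]
        congr 2
        show D i x = D i y
        rw [← hD.mul_left i x c hx1.1 hx1.2 hc, ← hD.mul_right i y _ hy1.1 hy1.2 hzc]
        congr 1
        group
      · exfalso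
        have hW : IsReduced H (invWord ys ++ (i, y⁻¹ * (c * x)) :: xs) := by
          refine isReduced_append.2 ⟨hy3.invWord, isReduced_cons.2 ⟨⟨?_, hzc⟩, hx2, hx3⟩, ?_⟩
          · exact mul_mem (inv_mem hy1.1) (mul_mem (core_le H i hc) hx1.1)
          · intro p hp q hq
            rw [getLast?_invWord] at hp
            simp only [Option.mem_def, Option.map_eq_some_iff] at hp
            obtain ⟨p', hp', rfl⟩ := hp
            simp only [List.head?_cons, Option.mem_def, Option.some.injEq] at hq
            subst hq
            exact (hy2 p' hp').symm
        refine hH _ hW (by simp) ?_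
        rw [value_append, value_cons, value_invWord, hz]
        simpa using hc'
    · exfalso
      have hW : IsReduced H (invWord ((j, y) :: ys) ++ (i, c * x) :: xs) := by
        refine isReduced_append.2 ⟨hy.invWord, isReduced_cons.2
          ⟨⟨mul_mem (core_le H i hc) hx1.1, ?_⟩, hx2, hx3⟩, ?_⟩
        · exact (mul_mem_core_iff_left hc).not.2 hx1.2
        · intro p hp q hq
          rw [getLast?_invWord] at hp
          simp only [List.head?_cons, Option.mem_def, Option.some.injEq, Option.map_some] at hp hq
          subst hp hq
          exact Ne.symm hij
      refine hH _ hW (by simp) ?_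
      rw [value_append, value_cons, value_invWord, value_cons, mul_assoc, h]
      simpa [mul_assoc] using hc'

theorem exists_isReduced_value_eq_mul {D : Bool → G → ℕ} (hD : IsWeight H D)
    {l : List (Bool × G)} (hl : IsReduced H l) (hne : l ≠ []) {c : G} (hc : c ∈ core H) :
    ∃ l', IsReduced H l' ∧ value l' = c * value l ∧ profile D l' = profile D l := by
  rcases l with _ | ⟨⟨i, x⟩, l⟩
  · exact absurd rfl hne
  obtain ⟨h1, h2, h3⟩ := isReduced_cons.1 hl
  refine ⟨(i, c * x) :: l, isReduced_cons.2
    ⟨⟨mul_mem (core_le H i hc) h1.1, (mul_mem_core_iff_left hc).not.2 h1.2⟩, h2, h3⟩,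
    by simp [mul_assoc], ?_⟩
  rw [profile_cons, profile_cons, hD.mul_left i x c h1.1 h1.2 hc]

/-- Conjugate reduced words of even length have the same types and weights of letters up to
a cyclic permutation; conjugation by the element of a reduced word. -/
theorem isRotated_profile_of_conj_value (hH : IsFree H) {D : Bool → G → ℕ} (hD : IsWeight H D)
    {m : List (Bool × G)} (hm : IsReduced H m) :
    ∀ {l l' : List (Bool × G)} {c c' : G}, IsReduced H l → IsReduced H l' → l ≠ [] →
      Even l.length → Even l'.length → c ∈ core H → c' ∈ core H →
      value m * value l * (value m)⁻¹ = c * value l' * c' → profile D l ~r profile D l' := by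
  induction m using List.reverseRecOn with
  | nil =>
    intro l l' c c' hl hl' _ _ _ hc hc' h
    rw [profile_eq_of_mul_value_eq hH hD hl hl' (inv_mem hc) hc' (by
      rw [inv_mul_eq_iff_eq_mul, ← mul_assoc, ← h]; simp)]
  | append_singleton m p ih =>
    obtain ⟨i, s⟩ := p
    obtain ⟨hm1, hs, hms⟩ := isReduced_append.1 hm
    replace ih := @ih hm1
    replace hs : s ∈ H i ∧ s ∉ core H := by simpa using hs.mem (i, s)
    have head : ∀ {x : G} {xs l' : List (Bool × G)} {c c' : G}, IsReduced H ((i, x) :: xs) →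
        IsReduced H l' → Even ((i, x) :: xs).length → Even l'.length → c ∈ core H → c' ∈ core H →
        value (m ++ [(i, s)]) * value ((i, x) :: xs) * (value (m ++ [(i, s)]))⁻¹ =
          c * value l' * c' →
        profile D ((i, x) :: xs) ~r profile D l' := by
      intro x xs l' c c' hl hl' hev hev' hc hc' h
      obtain ⟨hx1, hx2, hx3⟩ := isReduced_cons.1 hl
      have hlast : ∀ q ∈ xs.getLast?, i ≠ q.1 := by
        intro q hq
        refine (even_length_iff Prod.fst hl.chain (i, x) (by simp) q ?_).1 hev
        rw [List.getLast?_cons, Option.mem_def.1 hq]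
        rfl
      -- If the last letter `s` of the conjugator cancels the first letter `x` up to the core,
      -- conjugation by `s` rotates the word: `s⁻¹`, with the weight of `x`, appears at the end.
      by_cases hz : s * x ∈ core H
      · rcases xs with _ | ⟨⟨j, y⟩, ys⟩
        · simp at hev
        obtain ⟨hy1, hy2, hy3⟩ := isReduced_cons.1 hx3
        have hl2 : IsReduced H (((j, s * x * y) :: ys) ++ [(i, s⁻¹)]) := by
          refine isReduced_append.2 ⟨isReduced_cons.2 ⟨⟨mul_mem (core_le H j hz) hy1.1,
            (mul_mem_core_iff_left hz).not.2 hy1.2⟩, hy2, hy3⟩,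
            isReduced_cons.2 ⟨by simpa using hs, by simp, isReduced_nil⟩, ?_⟩
          intro q hq q' hq'
          simp only [List.head?_cons, Option.mem_def, Option.some.injEq] at hq'
          subst hq'
          rw [List.getLast?_cons] at hq hlast
          rcases hys : ys.getLast? with _ | t
          · rw [hys] at hq hlast
            obtain rfl : (j, s * x * y) = q := Option.some.inj hq
            exact (hlast (j, y) rfl).symm
          · rw [hys] at hq hlast
            exact (hlast q hq).symm
        have h2 := ih hl2 hl' (by simp) (by simpa [Nat.even_add_one] using hev) hev' hc hc' (by
          rw [← h]; simp [mul_assoc])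
        refine List.IsRotated.trans ?_ h2
        have e1 : D i s⁻¹ = D i x := by
          rw [← hD.mul_right i x _ hx1.1 hx1.2 (inv_mem hz)]
          congr 1
          group
        rw [profile_append, profile_cons, profile_cons, profile_cons,
          hD.mul_left j y _ hy1.1 hy1.2 hz, ← e1]
        exact List.IsRotated.cons_append_singleton
      · exfalso
        -- Without cancellation the conjugate is a reduced word of length `2 |m| + |l| + 1`, which
        -- is odd, whereas `l'` has even length.
        have hW : IsReduced H (m ++ ((i, s * x) :: xs ++ (i, s⁻¹) :: invWord m)) := by
          refine isReduced_append.2 ⟨hm1, isReduced_append.2 ⟨isReduced_cons.2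
            ⟨⟨mul_mem hs.1 hx1.1, hz⟩, hx2, hx3⟩, isReduced_cons.2
            ⟨by simpa using hs, ?_, hm1.invWord⟩, ?_⟩, ?_⟩
          · intro q hq
            rw [head?_invWord] at hq
            simp only [Option.mem_def, Option.map_eq_some_iff] at hq
            obtain ⟨q', hq', rfl⟩ := hq
            exact (hms q' hq' (i, s) (by simp)).symm
          · intro q hq q' hq'
            simp only [List.head?_cons, Option.mem_def, Option.some.injEq] at hq'
            subst hq'
            rw [List.getLast?_cons] at hq
            rcases hxs : xs.getLast? with _ | t
            · rw [List.getLast?_eq_none_iff] at hxs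
              subst hxs
              simp at hev
            · rw [hxs] at hq
              exact (hlast q (by rw [hxs]; exact hq)).symm
          · intro q hq q' hq'
            simp only [List.cons_append, List.head?_cons, Option.mem_def,
              Option.some.injEq] at hq'
            subst hq'
            exact hms q hq (i, s) (by simp)
        have h2 := congrArg List.length (profile_eq_of_mul_value_eq hH hD hW hl' (inv_mem hc) hc'
          (by rw [inv_mul_eq_iff_eq_mul, ← mul_assoc, ← h]; simp [mul_assoc]))
        simp only [length_profile, List.length_append, List.length_cons, length_invWord] at h2 hev
        rw [← h2] at hev'
        rw [Nat.even_iff] at hev hev'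
        omega
    intro l l' c c' hl hl' hne hev hev' hc hc' h
    rcases l with _ | ⟨⟨j, x⟩, xs⟩
    · exact absurd rfl hne
    by_cases hij : j = i
    · subst hij
      exact head hl hl' hev hev' hc hc' h
    -- Otherwise, by even length, the last letter of `l` has the type of `s`, and the previous case
    -- applies to the inverse words.
    · obtain ⟨q, hq⟩ : ∃ q, q ∈ ((j, x) :: xs).getLast? := ⟨_, List.getLast?_eq_getLast_of_ne_nil hne⟩
      have hjq := (even_length_iff Prod.fst hl.chain (j, x) (by simp) q hq).1 hev
      have hqi : q.1 = i := by
        revert hij hjq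
        cases q.1 <;> cases i <;> cases j <;> simp
      have hhead := head?_invWord ((j, x) :: xs)
      rw [Option.mem_def.1 hq] at hhead
      rcases hinv : invWord ((j, x) :: xs) with _ | ⟨⟨k, y⟩, ys⟩
      · simp [hinv] at hhead
      have hk : k = i := by
        rw [hinv] at hhead
        simp only [List.head?_cons, Option.map_some, Option.some.injEq, Prod.mk.injEq] at hhead
        rw [hhead.1, hqi]
      subst hk
      have h2 := head (hinv ▸ hl.invWord) hl'.invWord (by rw [← hinv]; simpa using hev)
        (by simpa using hev') (inv_mem hc') (inv_mem hc) (by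
          rw [← hinv, value_invWord, value_invWord, ← inv_inj]
          simpa [mul_assoc] using h)
      rw [← hinv, profile_invWord hD hl, profile_invWord hD hl', List.isRotated_reverse_iff] at h2
      exact h2

/-- A factor element multiplied from the left becomes a new first letter, merges with the first
letter, or is absorbed in the core. -/
theorem exists_eq_mul_value {g : G}
    (hg : g ∈ Subgroup.closure ((H true : Set G) ∪ (H false : Set G))) :
    ∃ b ∈ core H, ∃ m, IsReduced H m ∧ g = b * value m := by
  have step : ∀ (i : Bool) (t : G) (m : List (Bool × G)), t ∈ H i → IsReduced H m →
      ∃ b ∈ core H, ∃ m', IsReduced H m' ∧ t * value m = b * value m' := by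
    intro i t m ht hm
    by_cases htc : t ∈ core H
    · exact ⟨t, htc, m, hm, rfl⟩
    rcases m with _ | ⟨⟨j, y⟩, ys⟩
    · exact ⟨1, one_mem _, [(i, t)], isReduced_cons.2 ⟨⟨ht, htc⟩, by simp, hm⟩, by simp⟩
    obtain ⟨h1, h2, h3⟩ := isReduced_cons.1 hm
    by_cases hij : i = j
    · subst hij
      by_cases hty : t * y ∈ core H
      · exact ⟨t * y, hty, ys, h3, by simp [mul_assoc]⟩
      · exact ⟨1, one_mem _, (i, t * y) :: ys,
          isReduced_cons.2 ⟨⟨mul_mem ht h1.1, hty⟩, h2, h3⟩, by simp [mul_assoc]⟩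
    · exact ⟨1, one_mem _, (i, t) :: (j, y) :: ys,
        isReduced_cons.2 ⟨⟨ht, htc⟩, by simpa using hij, hm⟩, by simp⟩
  have step' : ∀ x ∈ (H true : Set G) ∪ (H false : Set G), ∀ y : G,
      (∃ b ∈ core H, ∃ m, IsReduced H m ∧ y = b * value m) →
      ∃ b ∈ core H, ∃ m, IsReduced H m ∧ x * y = b * value m := by
    rintro x hx _ ⟨b, hb, m, hm, rfl⟩
    rw [← mul_assoc]
    rcases hx with hx | hx
    · exact step true _ m (mul_mem hx (core_le H _ hb)) hm
    · exact step false _ m (mul_mem hx (core_le H _ hb)) hm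
  induction hg using Subgroup.closure_induction_left with
  | one => exact ⟨1, one_mem _, [], isReduced_nil, by simp⟩
  | mul_left x hx y _ ih => exact step' x hx y ih
  | inv_mul_cancel x hx y _ ih =>
    exact step' x⁻¹ (hx.imp (fun h => inv_mem h) (fun h => inv_mem h)) y ih

/-- Conjugate cyclically reduced elements have the same types and weights of letters up to
a cyclic permutation. -/
theorem isRotated_profile (hH : IsFree H)
    (hgen : ∀ g : G, g ∈ Subgroup.closure ((H true : Set G) ∪ (H false : Set G)))
    {D : Bool → G → ℕ} (hD : IsWeight H D) {l l' : List (Bool × G)} (hl : IsReduced H l)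
    (hl' : IsReduced H l') (hne : l ≠ []) (hev : Even l.length) (hev' : Even l'.length)
    {b b' r : G} (hb : b ∈ core H) (hb' : b' ∈ core H)
    (h : r * (b * value l) * r⁻¹ = b' * value l') : profile D l ~r profile D l' := by
  obtain ⟨l₀, h1, h2, h3⟩ := exists_isReduced_value_eq_mul hD hl hne hb
  obtain ⟨b₀, hb₀, m, hm, rfl⟩ := exists_eq_mul_value (hgen r)
  have hlen : l₀.length = l.length := by simpa using congrArg List.length h3
  rw [← h3]
  refine isRotated_profile_of_conj_value hH hD hm h1 hl' ?_ (hlen ▸ hev) hev'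
    (mul_mem (inv_mem hb₀) hb') hb₀ ?_
  · rw [← List.length_pos_iff, hlen]
    exact List.length_pos_iff.2 hne
  · rw [h2, mul_assoc b₀⁻¹, ← h]
    group

end AmalgamWord

/-! ### Affine and elementary transformations -/

namespace PolyAut

open MvPolynomial

variable {K : Type*} [Field K]

/-- The affine transformations as a subgroup. -/
noncomputable def affineSubgroup (K : Type*) [Field K] : Subgroup (PolyAut K) where
  carrier := affine K
  one_mem' := ⟨1, 0, fun i => by fin_cases i <;> simp [one_toPoly]⟩
  mul_mem' := by
    rintro f g ⟨M, a, hf⟩ ⟨N, b, hg⟩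
    refine ⟨M * N, fun i => M.1 i 0 * b 0 + M.1 i 1 * b 1 + a i, fun i => ?_⟩
    simp only [mul_toPoly, hf, hg, map_add, map_mul, bind₁_C_right, bind₁_X_right,
      Units.val_mul, Matrix.mul_apply, Fin.sum_univ_two]
    ring
  inv_mem' := by
    rintro f ⟨M, a, hf⟩
    refine ⟨M⁻¹, fun i => -(M⁻¹.1 i 0 * a 0 + M⁻¹.1 i 1 * a 1), fun i => ?_⟩
    have h0 := f.comp_inv 0
    have h1 := f.comp_inv 1
    simp only [hf, map_add, map_mul, bind₁_C_right, bind₁_X_right] at h0 h1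
    have hM : M⁻¹.1 * M.1 = 1 := by rw [← Units.val_mul, inv_mul_cancel, Units.val_one]
    have e : ∀ j, (C (M⁻¹.1 i 0) * C (M.1 0 j) + C (M⁻¹.1 i 1) * C (M.1 1 j) :
        MvPolynomial (Fin 2) K) = C ((1 : Matrix (Fin 2) (Fin 2) K) i j) := by
      intro j
      rw [← hM, Matrix.mul_apply, Fin.sum_univ_two, C_add, C_mul, C_mul]
    have e0 := e 0
    have e1 := e 1
    rw [inv_toPoly, C_neg, C_add, C_mul, C_mul, ← h0, ← h1]
    have hi : i = 0 ∨ i = 1 := by fin_cases i <;> simp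
    rcases hi with rfl | rfl
    · simp only [Matrix.one_apply_eq, C_1, ne_eq, zero_ne_one, not_false_eq_true,
        Matrix.one_apply_ne, C_0] at e0 e1 ⊢
      linear_combination (-f.invPoly 0) * e0 - f.invPoly 1 * e1
    · simp only [Matrix.one_apply_eq, C_1, ne_eq, one_ne_zero, not_false_eq_true,
        Matrix.one_apply_ne, C_0] at e0 e1 ⊢
      linear_combination (-f.invPoly 0) * e0 - f.invPoly 1 * e1

theorem mul_toPoly_elementary {f g : PolyAut K} {α β v α' β' v' : K} {P P' : Polynomial K}
    (hf0 : f.toPoly 0 = C α * X 0 + Polynomial.aeval (X 1) P)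
    (hf1 : f.toPoly 1 = C β * X 1 + C v)
    (hg0 : g.toPoly 0 = C α' * X 0 + Polynomial.aeval (X 1) P')
    (hg1 : g.toPoly 1 = C β' * X 1 + C v') :
    (f * g).toPoly 0 = C (α * α') * X 0 + Polynomial.aeval (X 1)
        (Polynomial.C α * P' + P.comp (Polynomial.C β' * Polynomial.X + Polynomial.C v')) ∧
      (f * g).toPoly 1 = C (β * β') * X 1 + C (β * v' + v) := by
  constructor
  · rw [mul_toPoly, hf0, map_add, map_mul, bind₁_C_right, bind₁_X_right, hg0,
      ← Polynomial.aeval_algHom_apply, bind₁_X_right, hg1]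
    simp only [map_add, map_mul, Polynomial.aeval_comp, Polynomial.aeval_C, Polynomial.aeval_X,
      MvPolynomial.algebraMap_eq]
    ring
  · rw [mul_toPoly, hf1, map_add, map_mul, bind₁_C_right, bind₁_C_right, bind₁_X_right, hg1,
      C_mul, C_add, C_mul]
    ring

/-- The elementary transformations as a subgroup. -/
noncomputable def elementarySubgroup (K : Type*) [Field K] : Subgroup (PolyAut K) where
  carrier := elementary K
  one_mem' := ⟨1, 1, 0, 0, by simp, by simp [one_toPoly], by simp [one_toPoly]⟩
  mul_mem' := by
    rintro f g ⟨α, β, v, P, hαβ, hf0, hf1⟩ ⟨α', β', v', P', hαβ', hg0, hg1⟩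
    obtain ⟨h0, h1⟩ := mul_toPoly_elementary hf0 hf1 hg0 hg1
    exact ⟨α * α', β * β', β * v' + v, _, by rw [mul_mul_mul_comm]; exact mul_ne_zero hαβ hαβ',
      h0, h1⟩
  inv_mem' := by
    rintro f ⟨α, β, v, P, hαβ, hf0, hf1⟩
    have hα := left_ne_zero_of_mul hαβ
    have hβ := right_ne_zero_of_mul hαβ
    have h0 := f.comp_inv 0
    have h1 := f.comp_inv 1
    have eα : (C α⁻¹ * C α : MvPolynomial (Fin 2) K) = 1 := by
      rw [← C_mul, inv_mul_cancel₀ hα, C_1]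
    have eβ : (C β⁻¹ * C β : MvPolynomial (Fin 2) K) = 1 := by
      rw [← C_mul, inv_mul_cancel₀ hβ, C_1]
    rw [hf0, map_add, map_mul, bind₁_C_right, bind₁_X_right, ← Polynomial.aeval_algHom_apply,
      bind₁_X_right] at h0
    rw [hf1, map_add, map_mul, bind₁_C_right, bind₁_C_right, bind₁_X_right] at h1
    have i1 : f.invPoly 1 = C β⁻¹ * X 1 + C (-(β⁻¹ * v)) := by
      rw [C_neg, C_mul]
      linear_combination C β⁻¹ * h1 - f.invPoly 1 * eβ
    refine ⟨α⁻¹, β⁻¹, -(β⁻¹ * v), -(Polynomial.C α⁻¹ * P.comp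
      (Polynomial.C β⁻¹ * Polynomial.X + Polynomial.C (-(β⁻¹ * v)))),
      mul_ne_zero (inv_ne_zero hα) (inv_ne_zero hβ), ?_, i1⟩
    rw [inv_toPoly, map_neg, map_mul, Polynomial.aeval_comp, map_add, map_mul,
      Polynomial.aeval_C, Polynomial.aeval_C, Polynomial.aeval_C, Polynomial.aeval_X,
      MvPolynomial.algebraMap_eq, ← i1]
    linear_combination C α⁻¹ * h0 - f.invPoly 0 * eα

/-- The two factors: the affine and the elementary transformations. -/
noncomputable def factor (K : Type*) [Field K] : Bool → Subgroup (PolyAut K)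
  | true => affineSubgroup K
  | false => elementarySubgroup K

theorem mem_closure_factor (g : PolyAut K) :
    g ∈ Subgroup.closure ((factor K true : Set (PolyAut K)) ∪ factor K false) :=
  g.mem_closure_affine_union_elementary

theorem mem_elementary_iff {g : PolyAut K} {M : GL (Fin 2) K} {a : Fin 2 → K}
    (hg : ∀ i, g.toPoly i = C (M.1 i 0) * X 0 + C (M.1 i 1) * X 1 + C (a i)) :
    g ∈ elementary K ↔ M.1 1 0 = 0 := by
  constructor
  · rintro ⟨α, β, v, P, -, -, h1⟩
    rw [hg] at h1
    have := congrArg (fun p => (aeval ![(Polynomial.X : Polynomial K), 0] p).coeff 1) h1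
    simpa [← Polynomial.C_eq_algebraMap, Polynomial.coeff_C] using this
  · intro h
    have hdet := M.isUnit.map Matrix.detMonoidHom
    rw [Matrix.coe_detMonoidHom, isUnit_iff_ne_zero, Matrix.det_fin_two, h, mul_zero, sub_zero] at hdet
    refine ⟨M.1 0 0, M.1 1 1, a 1, Polynomial.C (M.1 0 1) * Polynomial.X + Polynomial.C (a 0),
      hdet, ?_, ?_⟩
    · rw [hg]
      simp [MvPolynomial.algebraMap_eq, add_assoc]
    · rw [hg, h]
      simp

theorem mem_affine_iff {g : PolyAut K} {α β v : K} {P : Polynomial K} (hαβ : α * β ≠ 0)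
    (h0 : g.toPoly 0 = C α * X 0 + Polynomial.aeval (X 1) P)
    (h1 : g.toPoly 1 = C β * X 1 + C v) : g ∈ affine K ↔ P.natDegree ≤ 1 := by
  constructor
  · rintro ⟨M, a, hg⟩
    rw [hg] at h0
    have := congrArg (aeval ![0, (Polynomial.X : Polynomial K)]) h0
    simp only [map_add, map_mul, aeval_X, algHom_C, ← Polynomial.aeval_algHom_apply,
      Matrix.cons_val_zero, Matrix.cons_val_one, Polynomial.aeval_X_left_apply, mul_zero,
      zero_add, ← Polynomial.C_eq_algebraMap] at this
    rw [← this]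
    exact Polynomial.natDegree_linear_le
  · intro h
    obtain ⟨p₁, p₀, rfl⟩ := Polynomial.exists_eq_X_add_C_of_natDegree_le_one h
    refine ⟨Matrix.GeneralLinearGroup.mkOfDetNeZero !![α, p₁; 0, β] (by simpa using hαβ),
      ![p₀, v], fun i => ?_⟩
    fin_cases i
    · simp [h0, Matrix.GeneralLinearGroup.mkOfDetNeZero, MvPolynomial.algebraMap_eq, add_assoc]
    · simp [h1, Matrix.GeneralLinearGroup.mkOfDetNeZero]

theorem affineRep_mem (β : K) : affineRep β ∈ affine K ∧ affineRep β ∉ elementary K := by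
  have h : ∀ i, (affineRep β).toPoly i = C
      ((Matrix.GeneralLinearGroup.mkOfDetNeZero !![0, 1; 1, β] (by simp)).1 i 0) * X 0 + C
      ((Matrix.GeneralLinearGroup.mkOfDetNeZero !![0, 1; 1, β] (by simp)).1 i 1) * X 1 +
      C ((0 : Fin 2 → K) i) := by
    intro i
    fin_cases i <;> simp [affineRep, Matrix.GeneralLinearGroup.mkOfDetNeZero]
  refine ⟨⟨_, _, h⟩, ?_⟩
  rw [mem_elementary_iff h]
  simp [Matrix.GeneralLinearGroup.mkOfDetNeZero]

theorem elementaryRep_mem {P : Polynomial K} (hP : P ≠ 0) :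
    elementaryRep P ∈ elementary K ∧ elementaryRep P ∉ affine K := by
  have h0 : (elementaryRep P).toPoly 0 =
      C 1 * X 0 + Polynomial.aeval (X 1) (Polynomial.X ^ 2 * P) := by simp [elementaryRep]
  have h1 : (elementaryRep P).toPoly 1 = C 1 * X 1 + C 0 := by simp [elementaryRep]
  refine ⟨⟨1, 1, 0, _, by simp, h0, h1⟩, ?_⟩
  rw [mem_affine_iff (by simp) h0 h1, mul_comm, Polynomial.natDegree_mul_X_pow _ hP]
  omega

/-! ### Degrees of elementary transformations -/

theorem totalDegree_eq_wdeg (p : MvPolynomial (Fin 2) K) : p.totalDegree = wdeg ![1, 1] p := by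
  have hsum : ∀ m : Fin 2 →₀ ℕ, (m.sum fun _ e => e) = m 0 * ![1, 1] 0 + m 1 * ![1, 1] 1 := by
    intro m
    rw [Finsupp.sum_fintype _ _ (by simp), Fin.sum_univ_two]
    simp
  refine le_antisymm (Finset.sup_le fun m hm => ?_) (wdeg_le _ fun m hm => ?_)
  · rw [hsum]
    exact le_wdeg _ (mem_support_iff.1 hm)
  · rw [← hsum]
    exact le_totalDegree (mem_support_iff.2 hm)

theorem degree_eq_natDegree {g : PolyAut K} {α β v : K} {P : Polynomial K}
    (h0 : g.toPoly 0 = C α * X 0 + Polynomial.aeval (X 1) P)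
    (h1 : g.toPoly 1 = C β * X 1 + C v) (hP : 1 < P.natDegree) : g.degree = P.natDegree := by
  have e1 : wdeg ![1, 1] (C α * X 0 : MvPolynomial (Fin 2) K) ≤ 1 :=
    (wdeg_C_mul_le _ _ _).trans (wdeg_X _ _).le
  have e2 : wdeg ![1, 1] (Polynomial.aeval (X 1 : MvPolynomial (Fin 2) K) P) = P.natDegree := by
    rw [wdeg_aeval, wdeg_X]
    exact mul_one _
  have e3 : wdeg ![1, 1] (g.toPoly 1) ≤ 1 := by
    rw [h1]
    refine (wdeg_add_le _ _ _).trans (max_le ((wdeg_C_mul_le _ _ _).trans (wdeg_X _ _).le) ?_)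
    rw [wdeg_C]
    exact zero_le_one
  rw [degree, totalDegree_eq_wdeg, totalDegree_eq_wdeg, h0, wdeg_add_eq_right _ (by omega), e2]
  omega

/-- The nonlinear parts must cancel in the product, and the inner affine substitution preserves the
degree. Applied to `x * x⁻¹`, `(c * x) * x⁻¹` and `x⁻¹ * (x * c)`, this gives all the invariance
properties of the weight. -/
theorem degree_eq_of_mul_mem_affine {f g : PolyAut K} (hf : f ∈ elementary K) (hf' : f ∉ affine K)
    (hg : g ∈ elementary K) (hfg : f * g ∈ affine K) : f.degree = g.degree := by
  obtain ⟨α, β, v, P, hαβ, hf0, hf1⟩ := hf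
  obtain ⟨α', β', v', P', hαβ', hg0, hg1⟩ := hg
  obtain ⟨h0, h1⟩ := mul_toPoly_elementary hf0 hf1 hg0 hg1
  rw [mem_affine_iff (by rw [mul_mul_mul_comm]; exact mul_ne_zero hαβ hαβ') h0 h1] at hfg
  rw [mem_affine_iff hαβ hf0 hf1, not_le] at hf'
  have hcomp : (P.comp (Polynomial.C β' * Polynomial.X + Polynomial.C v')).natDegree =
      P.natDegree := by
    rw [Polynomial.natDegree_comp, Polynomial.natDegree_linear (right_ne_zero_of_mul hαβ'),
      mul_one]
  have hP' : P'.natDegree = P.natDegree := by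
    have e := Polynomial.natDegree_sub_eq_right_of_natDegree_lt
      (hfg.trans_lt (hf'.trans_eq hcomp.symm))
    rwa [add_sub_cancel_right, Polynomial.natDegree_C_mul (left_ne_zero_of_mul hαβ), hcomp] at e
  rw [degree_eq_natDegree hf0 hf1 hf', degree_eq_natDegree hg0 hg1 (hP' ▸ hf'), hP']

/-- The weight of a letter: the degree of an elementary one, and `0` for an affine one. -/
noncomputable def letterWeight (i : Bool) (g : PolyAut K) : ℕ := if i then 0 else g.degree

theorem isWeight_letterWeight : AmalgamWord.IsWeight (factor K) letterWeight := by
  have hinv : ∀ x : PolyAut K, x ∈ elementary K → x ∉ affine K → x⁻¹.degree = x.degree :=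
    fun x h1 h2 => (degree_eq_of_mul_mem_affine h1 h2 ((elementarySubgroup K).inv_mem h1)
      (by rw [mul_inv_cancel]; exact (affineSubgroup K).one_mem)).symm
  have hna : ∀ {x : PolyAut K}, x ∈ elementary K → x ∉ AmalgamWord.core (factor K) →
      x ∉ affine K := fun h1 h2 h3 => h2 ⟨h3, h1⟩
  constructor
  · rintro (_ | _) x c hx hxc hc
    · have h2 : c * x ∉ AmalgamWord.core (factor K) :=
        (AmalgamWord.mul_mem_core_iff_left hc).not.2 hxc
      have h1 : c * x ∈ elementary K := (elementarySubgroup K).mul_mem hc.2 hx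
      simp only [letterWeight, Bool.false_eq_true, if_false]
      rw [← hinv x hx (hna hx hxc)]
      exact degree_eq_of_mul_mem_affine h1 (hna h1 h2) ((elementarySubgroup K).inv_mem hx)
        (by rw [mul_inv_cancel_right]; exact hc.1)
    · rfl
  · rintro (_ | _) x c hx hxc hc
    · simp only [letterWeight, Bool.false_eq_true, if_false]
      have h1 : x⁻¹ ∈ elementary K := (elementarySubgroup K).inv_mem hx
      rw [← hinv x hx (hna hx hxc)]
      exact (degree_eq_of_mul_mem_affine h1 (hna h1 (by rwa [inv_mem_iff]))
        ((elementarySubgroup K).mul_mem hx hc.2) (by rw [inv_mul_cancel_left]; exact hc.1)).symm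
    · rfl
  · rintro (_ | _) x hx hxc
    · exact hinv x hx (hna hx hxc)
    · rfl

end PolyAut

/-! ### The amalgamated structure and normal forms -/

namespace PolyAut

open MvPolynomial AmalgamWord

variable {K : Type*} [Field K]

theorem not_mem_affine_of_not_mem_core {g : PolyAut K} (h : g ∈ elementary K)
    (hg : g ∉ core (factor K)) : g ∉ affine K := fun h' => hg ⟨h', h⟩

theorem wdeg_affine_le (w : Fin 2 → ℕ) (a b c : K) {p q : MvPolynomial (Fin 2) K} {N : ℕ}
    (hp : wdeg w p ≤ N) (hq : wdeg w q ≤ N) : wdeg w (C a * p + C b * q + C c) ≤ N := by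
  refine (wdeg_add_le _ _ _).trans (max_le ((wdeg_add_le _ _ _).trans (max_le ?_ ?_)) ?_)
  · exact (wdeg_C_mul_le _ _ _).trans hp
  · exact (wdeg_C_mul_le _ _ _).trans hq
  · rw [wdeg_C]
    exact Nat.zero_le _

/-- The degrees of the components of a reduced word. -/
theorem wdeg_value {l : List (Bool × PolyAut K)} (hl : IsReduced (factor K) l) :
    2 ≤ wdeg ![3, 2] ((value l).toPoly 1) ∧
    ((∀ p ∈ l.head?, p.1 = false) →
      wdeg ![3, 2] ((value l).toPoly 1) < wdeg ![3, 2] ((value l).toPoly 0)) ∧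
    ((∀ p ∈ l.head?, p.1 = true) →
      wdeg ![3, 2] ((value l).toPoly 0) < 2 * wdeg ![3, 2] ((value l).toPoly 1)) ∧
    (l ≠ [] → 4 ≤ wdeg ![3, 2] ((value l).toPoly 0) ∨
      3 ≤ wdeg ![3, 2] ((value l).toPoly 1)) := by
  -- The weights `(3, 2)` let the empty word satisfy both strict inequalities, so it can precede
  -- either type of letter. An elementary letter raises the degree of the first component to at
  -- least twice that of the second; an affine letter gives the second component the larger degree
  -- of the first.
  induction l with
  | nil => simp [one_toPoly, wdeg_X]
  | cons p l ih =>
    obtain ⟨i, x⟩ := p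
    obtain ⟨⟨hx, hxc⟩, hhead, hl'⟩ := isReduced_cons.1 hl
    obtain ⟨ih2, ihE, ihA, -⟩ := ih hl'
    simp only [value_cons, mul_toPoly] at *
    set p := (value l).toPoly 0 with hp
    set q := (value l).toPoly 1 with hq
    cases i with
    | true =>
      have h1 := ihE fun r hr => by simpa using (hhead r hr).symm
      obtain ⟨M, a, hM⟩ := hx
      have hM10 : M.1 1 0 ≠ 0 := fun h => hxc ⟨⟨M, a, hM⟩, (mem_elementary_iff hM).2 h⟩
      have e : ∀ i, bind₁ (value l).toPoly (x.toPoly i) =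
          C (M.1 i 0) * p + C (M.1 i 1) * q + C (a i) := by
        intro i
        rw [hM]
        simp [hp, hq]
      have e0 : wdeg ![3, 2] (bind₁ (value l).toPoly (x.toPoly 0)) ≤ wdeg ![3, 2] p := by
        rw [e]
        exact wdeg_affine_le _ _ _ _ le_rfl h1.le
      have e1 : wdeg ![3, 2] (bind₁ (value l).toPoly (x.toPoly 1)) = wdeg ![3, 2] p := by
        rw [e, add_assoc, wdeg_add_eq_left, wdeg_C_mul _ hM10]
        rw [wdeg_C_mul _ hM10]
        refine (wdeg_add_le _ _ _).trans_lt (max_lt ((wdeg_C_mul_le _ _ _).trans_lt h1) ?_)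
        rw [wdeg_C]
        omega
      refine ⟨by omega, by simp, fun _ => by omega, fun _ => by omega⟩
    | false =>
      have h1 := ihA fun r hr => by simpa using (hhead r hr).symm
      have hna := not_mem_affine_of_not_mem_core hx hxc
      obtain ⟨α, β, v, P, hαβ, h0, h1'⟩ := hx
      rw [mem_affine_iff hαβ h0 h1', not_le] at hna
      have e1 : wdeg ![3, 2] (bind₁ (value l).toPoly (x.toPoly 1)) = wdeg ![3, 2] q := by
        rw [h1', map_add, map_mul, bind₁_C_right, bind₁_C_right, bind₁_X_right,
          wdeg_add_eq_left, wdeg_C_mul _ (right_ne_zero_of_mul hαβ)]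
        rw [wdeg_C_mul _ (right_ne_zero_of_mul hαβ), wdeg_C]
        exact Nat.zero_lt_of_lt ih2
      have e2 : 2 * wdeg ![3, 2] q ≤ P.natDegree * wdeg ![3, 2] q := Nat.mul_le_mul_right _ hna
      have e0 : wdeg ![3, 2] (bind₁ (value l).toPoly (x.toPoly 0)) =
          P.natDegree * wdeg ![3, 2] q := by
        rw [h0, map_add, map_mul, bind₁_C_right, bind₁_X_right, ← Polynomial.aeval_algHom_apply,
          bind₁_X_right, wdeg_add_eq_right, wdeg_aeval]
        rw [wdeg_aeval]
        exact (wdeg_C_mul_le _ _ _).trans_lt (h1.trans_le e2)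
      rw [e0, e1]
      generalize P.natDegree * wdeg ![3, 2] q = n at e2 ⊢
      exact ⟨ih2, fun _ => by omega, by simp, fun _ => Or.inl (by omega)⟩

theorem isFree_factor : IsFree (factor K) := by
  rintro l hl hne ⟨⟨M, a, hM⟩, ⟨α, β, v, P, -, -, h1⟩⟩
  obtain ⟨-, -, -, h⟩ := wdeg_value hl
  -- A basic transformation keeps the degrees at most `3` and `2`, which a nonempty reduced word
  -- exceeds.
  have e0 : wdeg ![3, 2] ((value l).toPoly 0) ≤ 3 := by
    rw [hM]
    exact wdeg_affine_le _ _ _ _ (wdeg_X _ _).le ((wdeg_X _ _).le.trans (by simp))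
  have e1 : wdeg ![3, 2] ((value l).toPoly 1) ≤ 2 := by
    rw [h1]
    refine (wdeg_add_le _ _ _).trans (max_le ((wdeg_C_mul_le _ _ _).trans (wdeg_X _ _).le) ?_)
    rw [wdeg_C]
    exact Nat.zero_le _
  have := h hne
  omega

/-! ### Normal forms as reduced words -/

/-- A word in the coset representatives as a word in the two factors. -/
noncomputable def letters (l : List (Letter K)) : List (Bool × PolyAut K) :=
  l.map fun x => (x.isAff, x.toAut)

theorem letters_cons (x : Letter K) (l : List (Letter K)) :
    letters (x :: l) = (x.isAff, x.toAut) :: letters l := rfl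

theorem value_letters (l : List (Letter K)) :
    value (letters l) = (l.map Letter.toAut).prod := by
  simp [value, letters, Function.comp_def]

theorem isReduced_letters {l : List (Letter K)} (h : l.IsChain fun x y => x.isAff ≠ y.isAff) :
    IsReduced (factor K) (letters l) := by
  refine ⟨fun p hp => ?_, (List.isChain_map _).2 h⟩
  obtain ⟨x, -, rfl⟩ := List.mem_map.1 hp
  cases x with
  | aff β => exact ⟨(affineRep_mem β).1, fun h => (affineRep_mem β).2 h.2⟩
  | elem P hP => exact ⟨(elementaryRep_mem hP).1, fun h => (elementaryRep_mem hP).2 h.1⟩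

/-- The weights of the elementary letters. -/
def elementaryWeights (l : List (Bool × ℕ)) : List ℕ := (l.filter fun p => !p.1).map Prod.snd

theorem elementaryWeights_profile_letters (l : List (Letter K)) :
    elementaryWeights (profile letterWeight (letters l)) =
      (l.filter fun x => !x.isAff).map fun x => x.toAut.degree := by
  induction l with
  | nil => rfl
  | cons x l ih =>
    rw [letters_cons, profile_cons]
    cases x <;> simpa [elementaryWeights, Letter.isAff, letterWeight] using ih

theorem elementaryWeights_reverse (l : List (Bool × ℕ)) :
    elementaryWeights l.reverse = (elementaryWeights l).reverse := by
  rw [elementaryWeights, List.filter_reverse, List.map_reverse, elementaryWeights]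

theorem elementaryWeights_isRotated {l l' : List (Bool × ℕ)} (h : l ~r l') :
    elementaryWeights l ~r elementaryWeights l' := by
  obtain ⟨n, -, rfl⟩ := List.isRotated_iff_mod.1 h
  obtain ⟨a, b, rfl, h2⟩ : ∃ a b, l = a ++ b ∧ l.rotate n = b ++ a :=
    ⟨l.take (n % l.length), l.drop (n % l.length), (List.take_append_drop _ _).symm,
      List.rotate_eq_drop_append_take_mod⟩
  rw [h2]
  simp only [elementaryWeights, List.filter_append, List.map_append]
  exact List.isRotated_append

/-- By uniqueness of profiles, neither the chosen normal form nor the choice of reduced word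
matters. -/
theorem polyDegree_eq {g b : PolyAut K} {l : List (Bool × PolyAut K)}
    (hl : IsReduced (factor K) l) (hb : b ∈ basic K)
    (hex : ∃ w : NormalForm K, w.toAut = g) (hg : g = b * value l) :
    g.polyDegree = elementaryWeights (profile letterWeight l) := by
  rw [polyDegree, dif_pos hex, NormalForm.degrees, ← elementaryWeights_profile_letters]
  congr 1
  have h := hex.choose_spec
  generalize hex.choose = w at h ⊢
  rw [hg, NormalForm.toAut, ← value_letters] at h
  exact profile_eq_of_mul_value_eq isFree_factor isWeight_letterWeight
    (isReduced_letters w.alternating) hl (mul_mem (inv_mem hb) w.b_mem) (one_mem _)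
    (by rw [mul_assoc, h]; group)

/-- An elementary or affine letter is a coset representative up to a basic transformation. -/
theorem exists_letter {i : Bool} {x : PolyAut K} (hx : x ∈ factor K i)
    (hxc : x ∉ core (factor K)) :
    ∃ b ∈ core (factor K), ∃ y : Letter K, y.isAff = i ∧ x = b * y.toAut := by
  cases i with
  | true =>
    obtain ⟨M, a, hM⟩ := id hx
    have hM10 : M.1 1 0 ≠ 0 := fun h => hxc ⟨hx, (mem_elementary_iff hM).2 h⟩
    have hdet := M.isUnit.map Matrix.detMonoidHom
    rw [Matrix.coe_detMonoidHom, isUnit_iff_ne_zero, Matrix.det_fin_two] at hdet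
    -- This `β` removes `x` from the second component of `x * (affineRep β)⁻¹`.
    set β := M.1 1 1 / M.1 1 0 with hβ
    have hβM : β * M.1 1 0 = M.1 1 1 := div_mul_cancel₀ _ hM10
    refine ⟨x * (affineRep β)⁻¹, ⟨(affineSubgroup K).mul_mem hx
      ((affineSubgroup K).inv_mem (affineRep_mem β).1), ?_⟩, .aff β, rfl, by simp [Letter.toAut]⟩
    refine ⟨M.1 0 1 - β * M.1 0 0, M.1 1 0, a 1,
      Polynomial.C (M.1 0 0) * Polynomial.X + Polynomial.C (a 0), ?_, ?_, ?_⟩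
    · intro h
      refine hdet ?_
      linear_combination -h - M.1 0 0 * hβM
    · rw [mul_toPoly, hM]
      simp [inv_toPoly, affineRep, MvPolynomial.algebraMap_eq]
      ring
    · rw [mul_toPoly, hM, ← hβM]
      simp [inv_toPoly, affineRep]
      ring
  | false =>
    have hna := not_mem_affine_of_not_mem_core hx hxc
    obtain ⟨α, β, v, P, hαβ, h0, h1⟩ := id hx
    rw [mem_affine_iff hαβ h0 h1, not_le] at hna
    have hα := left_ne_zero_of_mul hαβ
    have hP : P.divX.divX * Polynomial.X ^ 2 + Polynomial.C (P.coeff 1) * Polynomial.X +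
        Polynomial.C (P.coeff 0) = P := by
      have h2 := P.divX_mul_X_add
      have h3 := P.divX.divX_mul_X_add
      rw [Polynomial.coeff_divX] at h3
      conv_rhs => rw [← h2, ← h3]
      ring
    have hP0 : Polynomial.C α⁻¹ * P.divX.divX ≠ 0 := by
      refine mul_ne_zero (Polynomial.C_ne_zero.2 (inv_ne_zero hα)) fun h => ?_
      rw [h, zero_mul, zero_add] at hP
      have := Polynomial.natDegree_linear_le (a := P.coeff 1) (b := P.coeff 0)
      rw [hP] at this
      omega
    -- The representative takes away the terms of `P` of degree at least `2`; the factor `α⁻¹`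
    -- compensates for the scaling of the first coordinate.
    refine ⟨x * (elementaryRep (Polynomial.C α⁻¹ * P.divX.divX))⁻¹, ⟨?_,
      (elementarySubgroup K).mul_mem hx ((elementarySubgroup K).inv_mem
        (elementaryRep_mem hP0).1)⟩, .elem _ hP0, rfl, by simp [Letter.toAut]⟩
    refine ⟨Matrix.GeneralLinearGroup.mkOfDetNeZero !![α, P.coeff 1; 0, β] (by simpa using hαβ),
      ![P.coeff 0, v], fun i => ?_⟩
    have eα : (C α * C α⁻¹ : MvPolynomial (Fin 2) K) = 1 := by
      rw [← C_mul, mul_inv_cancel₀ hα, C_1]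
    have hi : i = 0 ∨ i = 1 := by fin_cases i <;> simp
    rcases hi with rfl | rfl
    · have hP' := congrArg (Polynomial.aeval (X 1 : MvPolynomial (Fin 2) K)) hP
      simp only [map_add, map_mul, map_pow, Polynomial.aeval_X, Polynomial.aeval_C,
        MvPolynomial.algebraMap_eq] at hP'
      rw [mul_toPoly, h0]
      simp [inv_toPoly, elementaryRep, Matrix.GeneralLinearGroup.mkOfDetNeZero,
        MvPolynomial.algebraMap_eq, ← Polynomial.aeval_algHom_apply]
      rw [← hP']
      linear_combination (-X 1 ^ 2 * Polynomial.aeval (X 1) P.divX.divX) * eα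
    · rw [mul_toPoly, h1]
      simp [inv_toPoly, elementaryRep, Matrix.GeneralLinearGroup.mkOfDetNeZero]

/-- The letters are normalized from right to left, each pushing its basic factor into the letter on
its left. -/
theorem exists_letters {l : List (Bool × PolyAut K)} (hl : IsReduced (factor K) l)
    {c : PolyAut K} (hc : c ∈ core (factor K)) :
    ∃ w : NormalForm K, w.toAut = value l * c ∧
      profile letterWeight (letters w.word) = profile letterWeight l := by
  suffices h : ∃ b ∈ core (factor K), ∃ v : List (Letter K),
      value l * c = b * value (letters v) ∧
        profile letterWeight (letters v) = profile letterWeight l by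
    obtain ⟨b, hb, v, h1, h2⟩ := h
    refine ⟨⟨b, hb, v, ?_⟩, ?_, h2⟩
    · have h3 : (profile letterWeight l).IsChain fun p q => p.1 ≠ q.1 :=
        (List.isChain_map _).2 hl.chain
      rw [← h2, profile, letters, List.map_map, List.isChain_map] at h3
      exact h3
    · rw [NormalForm.toAut, h1, value_letters]
  induction l with
  | nil => exact ⟨c, hc, [], by simp [letters], rfl⟩
  | cons p l ih =>
    obtain ⟨i, x⟩ := p
    obtain ⟨⟨hx, hxc⟩, -, hl'⟩ := isReduced_cons.1 hl
    obtain ⟨b, hb, v, h1, h2⟩ := ih hl'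
    have hxb : x * b ∉ core (factor K) := (Subgroup.mul_mem_cancel_right _ hb).not.2 hxc
    have hxb' : x * b ∈ factor K i := mul_mem hx (core_le _ i hb)
    obtain ⟨b', hb', y, rfl, hy⟩ := exists_letter hxb' hxb
    refine ⟨b', hb', y :: v, ?_, ?_⟩
    · rw [value_cons, mul_assoc, h1, letters_cons, value_cons, ← mul_assoc, ← mul_assoc, hy]
    · rw [letters_cons, profile_cons, profile_cons, h2]
      congr 2
      have e : y.toAut = b'⁻¹ * (x * b) := by rw [hy]; group
      show letterWeight y.isAff y.toAut = letterWeight y.isAff x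
      rw [e, isWeight_letterWeight.mul_left _ _ _ hxb' hxb (inv_mem hb'),
        isWeight_letterWeight.mul_right _ _ _ hx hxc hb]

/-- Alternation turns cyclic reducedness into a parity condition, which is visibly stable under
inversion. -/
theorem even_length_letters_iff (w : NormalForm K) (h : w.word ≠ []) :
    Even (letters w.word).length ↔ (w.word.head h).isAff ≠ (w.word.getLast h).isAff := by
  rw [letters, List.length_map]
  exact even_length_iff Letter.isAff w.alternating _ (List.head?_eq_some_head h ▸ rfl) _
    (List.getLast?_eq_some_getLast h ▸ rfl)

theorem HasCRNF.exists_word {g : PolyAut K} (hg : g.HasCRNF) :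
    ∃ b ∈ core (factor K), ∃ l, IsReduced (factor K) l ∧ l ≠ [] ∧ Even l.length ∧
      g = b * value l ∧ g.polyDegree = elementaryWeights (profile letterWeight l) := by
  obtain ⟨w, hw, hne, hcr⟩ := hg
  have hl := isReduced_letters w.alternating
  have e : g = w.b * value (letters w.word) := by rw [← hw, NormalForm.toAut, value_letters]
  exact ⟨w.b, w.b_mem, letters w.word, hl, by simpa [letters] using hne,
    (even_length_letters_iff w hne).2 hcr, e, polyDegree_eq hl w.b_mem ⟨w, hw⟩ e⟩

theorem hasCRNF_value_mul {l : List (Bool × PolyAut K)} (hl : IsReduced (factor K) l)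
    (hne : l ≠ []) (hev : Even l.length) {c : PolyAut K} (hc : c ∈ core (factor K)) :
    (value l * c).HasCRNF ∧
      (value l * c).polyDegree = elementaryWeights (profile letterWeight l) := by
  obtain ⟨w, hw, hp⟩ := exists_letters hl hc
  have hlen : (letters w.word).length = l.length := by simpa using congrArg List.length hp
  have hne' : w.word ≠ [] := by
    intro h
    rw [h] at hlen
    exact hne (List.length_eq_zero_iff.1 hlen.symm)
  refine ⟨⟨w, hw, hne', (even_length_letters_iff w hne').1 (hlen ▸ hev)⟩, ?_⟩
  rw [← hp]
  exact polyDegree_eq (isReduced_letters w.alternating) w.b_mem ⟨w, hw⟩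
    (by rw [← hw, NormalForm.toAut, value_letters])

theorem HasCRNF.inv {g : PolyAut K} (hg : g.HasCRNF) :
    g⁻¹.HasCRNF ∧ g⁻¹.polyDegree = g.polyDegree.reverse := by
  obtain ⟨b, hb, l, hl, hne, hev, rfl, hpd⟩ := hg.exists_word
  have h := hasCRNF_value_mul hl.invWord
    (by rw [← List.length_pos_iff, length_invWord]; exact List.length_pos_iff.2 hne)
    (by rwa [length_invWord]) (inv_mem hb)
  rw [value_invWord, ← mul_inv_rev, profile_invWord isWeight_letterWeight hl,
    elementaryWeights_reverse, ← hpd] at h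
  exact h

/-- Conjugate elements with cyclically reduced normal forms have the same poly-degree up to
a cyclic permutation. -/
theorem HasCRNF.isRotated_polyDegree {g h : PolyAut K} (hg : g.HasCRNF) (hh : h.HasCRNF)
    (hgh : IsConj g h) : g.polyDegree ~r h.polyDegree := by
  obtain ⟨r, hr⟩ := isConj_iff.1 hgh
  obtain ⟨b, hb, l, hl, hne, hev, rfl, hpd⟩ := hg.exists_word
  obtain ⟨b', hb', l', hl', -, hev', rfl, hpd'⟩ := hh.exists_word
  rw [hpd, hpd']
  exact elementaryWeights_isRotated (isRotated_profile isFree_factor mem_closure_factor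
    isWeight_letterWeight hl hl' hne hev hev' hb hb' hr)

end PolyAut

/-! ### Reversibility and the poly-degree -/

theorem mainTheorem12 (K : Type*) [Field K] :
    (∀ g : PolyAut K, g.HasCRNF →
      g⁻¹.HasCRNF ∧ g⁻¹.polyDegree = g.polyDegree.reverse ∧
        (g.IsReversible → g.PolyDegreeCondition)) ∧
    (∀ g' : PolyAut K, g'.IsCR →
      (∃ g : PolyAut K, IsConj g' g ∧ g.HasCRNF) ∧
      (g'.IsReversible → ∀ g : PolyAut K, IsConj g' g → g.HasCRNF → g.PolyDegreeCondition) ∧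
      (∀ g₁ g₂ : PolyAut K, IsConj g' g₁ → g₁.HasCRNF → IsConj g' g₂ → g₂.HasCRNF →
        (g₁.PolyDegreeCondition ↔ g₂.PolyDegreeCondition))) := by
  have hrev : ∀ g : PolyAut K, g.HasCRNF → IsConj g g⁻¹ → g.PolyDegreeCondition :=
    fun g hg h => (hg.isRotated_polyDegree hg.inv.1 h).symm
  have hcond : ∀ g₁ g₂ : PolyAut K, IsConj g₁ g₂ → g₁.HasCRNF → g₂.HasCRNF →
      g₁.PolyDegreeCondition → g₂.PolyDegreeCondition := by
    intro g₁ g₂ h h₁ h₂ hc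
    have hr := h₁.isRotated_polyDegree h₂ h
    rw [PolyAut.PolyDegreeCondition, h₁.inv.2] at hc
    rw [PolyAut.PolyDegreeCondition, h₂.inv.2]
    -- Reversal respects cyclic permutation, so the condition depends only on the cyclic class of
    -- the poly-degree.
    exact (hr.symm.reverse.trans hc).trans hr
  refine ⟨fun g hg => ⟨hg.inv.1, hg.inv.2, fun h => hrev g hg (isConj_iff.2 h)⟩,
    fun g' hg' => ⟨hg', fun h g hc hg => ?_, fun g₁ g₂ hc₁ h₁ hc₂ h₂ =>
      ⟨hcond _ _ (hc₁.symm.trans hc₂) h₁ h₂, hcond _ _ (hc₂.symm.trans hc₁) h₂ h₁⟩⟩⟩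
  refine hrev g hg ?_
  obtain ⟨c, rfl⟩ := isConj_iff.1 hc
  have h1 : IsConj g'⁻¹ (c * g' * c⁻¹)⁻¹ := isConj_iff.2 ⟨c, by group⟩
  exact (hc.symm.trans (isConj_iff.2 h)).trans h1
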